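/- Let $(E,\rho)$ be a metric space in which every closed ball is compact, and let $(X(t))_{t\ge 0}$ be a conservative standard Markov process with values in $E$ and laws $(\mathbb P^x)_{x\in E}$, $\mathbb P^x(X(0)=x)=1$ (that is, a strong Markov process, càdlàg and quasi-left-continuous, with respect to a complete and right-continuous filtration). Write $\mathbb E^x$ for the expectation under $\mathbb P^x$, and assume the weak Feller property: for every $t\ge 0$ the operator $P_th(x)=\mathbb E^x\{h(X(t))\}$ maps the space $\mathcal C_0$ of continuous functions on $E$ vanishing at infinity into itself. Let $\mathcal O\subseteq E$ be open, $\tau_{\mathcal O}=\inf\{t\ge 0: X(t)\notin\mathcal O\}$ (with $\inf\emptyset=\infty$), let $\alpha,\beta>0$, and let $f,G,H:[0,\infty)\times E\to\mathbb R$ be bounded and continuous. Assume (A1) for every $t>0$ the operator $h\mapsto \big(x\mapsto \mathbb E^x\{1_{\{t<\tau_{\mathcal O}\}}h(X(t))\}\big)$ maps the space of bounded continuous functions on $E$ into itself. For a bounded Borel measurable $\varphi:[0,\infty)\times E\to\mathbb R$ put $$\mathcal T\varphi(s,x)=\mathbb E^x\Big\{\int_0^{\tau_{\mathcal O}}e^{-(\alpha+\beta)u}\big[f+\beta(G-\varphi)^++\beta\varphi\big](s+u,X(u))\,du+e^{-(\alpha+\beta)\tau_{\mathcal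 O}}H(s+\tau_{\mathcal O},X(\tau_{\mathcal O}))\Big\},$$ where terms containing $e^{-\gamma\tau_{\mathcal O}}$ with $\gamma>0$ are $0$ on $\{\tau_{\mathcal O}=\infty\}$. Then: 1. $\mathcal T$ maps bounded Borel measurable functions to bounded Borel measurable functions, and $\|\mathcal T\varphi_1-\mathcal T\varphi_2\|_\infty\le\frac{\beta}{\alpha+\beta}\|\varphi_1-\varphi_2\|_\infty$ for all such $\varphi_1,\varphi_2$. 2. $\mathcal T$ maps the space of bounded continuous functions on $[0,\infty)\times E$ into itself, and is a contraction on it with constant $\frac{\beta}{\alpha+\beta}<1$. 3. There is exactly one bounded Borel measurable function $w^\beta:[0,\infty)\times E\to\mathbb R$ that satisfies the penalized equation $$w^\beta(s,x)=\mathbb E^x\Big\{\int_0^{\tau_{\mathcal O}}e^{-\alpha u}\big[f+\beta(G-w^\beta)^+\big](s+u,X(u))\,du+e^{-\alpha\tau_{\mathcal O}}H(s+\tau_{\mathcal O},X(\tau_{\mathcal O}))\Big\}$$ for all $(s,x)\in[0,\infty)\times E$. It is continuous, and it is the unique fixed point of $\mathcal T$ among bounded Borel measurable functions. -/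

import Mathlib

open MeasureTheory Filter Topology
open scoped NNReal BoundedContinuousFunction ZeroAtInfty

/-- A conservative standard Markov process `(Ω, 𝓕, 𝓕ₜ, X(t), ℙˣ)` with state space `E` and time set
`[0, ∞)`: a strong Markov process which is càdlàg and quasi-left-continuous, with respect to a
filtration which is complete and right-continuous. -/
structure StandardMarkovProcess (E : Type*) [TopologicalSpace E] [MeasurableSpace E]
    (Ω : Type*) [mΩ : MeasurableSpace Ω] where
  /-- The law `ℙˣ` of the process started at `x`. -/
  P : E → Measure Ω
  /-- The process. -/
  X : ℝ≥0 → Ω → E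
  /-- The filtration. -/
  F : Filtration ℝ≥0 mΩ
  isProbabilityMeasure : ∀ x, IsProbabilityMeasure (P x)
  start : ∀ x, ∀ᵐ ω ∂(P x), X 0 ω = x
  adapted : ∀ t, Measurable[F t] (X t)
  measurable_transition : ∀ t (B : Set E), MeasurableSet B → Measurable fun x => P x (X t ⁻¹' B)
  /-- Paths are right-continuous. -/
  rightContinuous : ∀ ω t, ContinuousWithinAt (fun u => X u ω) (Set.Ici t) t
  /-- Paths have left limits in `E`. -/
  leftLimits : ∀ ω t, ∃ l, Tendsto (fun u => X u ω) (𝓝[<] t) (𝓝 l)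
  /-- The filtration is right-continuous. -/
  filtration_rightContinuous : F.IsRightContinuous
  /-- The filtration is complete: events that are negligible under every `ℙˣ` belong to
  every `𝓕ₜ`. -/
  filtration_complete : ∀ t (A : Set Ω), MeasurableSet A → (∀ x, P x A = 0) → MeasurableSet[F t] A
  /-- Strong Markov property: `ℙˣ(X(τ + t) ∈ B | 𝓕_τ) = ℙ^{X(τ)}(X(t) ∈ B)` on `{τ < ∞}`. -/
  strongMarkov : ∀ (τ : Ω → WithTop ℝ≥0) (hτ : IsStoppingTime F τ) (t : ℝ≥0) (B : Set E),
    MeasurableSet B → ∀ (x : E) (A : Set Ω), MeasurableSet[hτ.measurableSpace] A →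
      P x (A ∩ {ω | τ ω < ⊤} ∩ {ω | stoppedValue X (fun ω' => τ ω' + t) ω ∈ B}) =
        ∫⁻ ω in A ∩ {ω | τ ω < ⊤}, P (stoppedValue X τ ω) (X t ⁻¹' B) ∂(P x)
  /-- Quasi-left-continuity: if stopping times `τₙ` increase to `σ`, then `X(τₙ) → X(σ)` almost
  surely on `{σ < ∞}`. -/
  quasiLeftContinuous : ∀ (τ : ℕ → Ω → WithTop ℝ≥0) (σ : Ω → WithTop ℝ≥0),
    (∀ n, IsStoppingTime F (τ n)) → Monotone τ →
    (∀ ω, IsLUB (Set.range fun n => τ n ω) (σ ω)) →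
      ∀ x, ∀ᵐ ω ∂(P x), σ ω < ⊤ →
        Tendsto (fun n => stoppedValue X (τ n) ω) atTop (𝓝 (stoppedValue X σ ω))

namespace StandardMarkovProcess

variable {E : Type*} [TopologicalSpace E] [MeasurableSpace E]
  {Ω : Type*} [MeasurableSpace Ω] (M : StandardMarkovProcess E Ω)

/-- The weak Feller property `Pₜ 𝒞₀ ⊆ 𝒞₀`, where `Pₜ h(x) = 𝔼ˣ[h(X(t))]`. -/
def WeakFeller : Prop :=
  ∀ (t : ℝ≥0) (h : C₀(E, ℝ)), ∃ g : C₀(E, ℝ), ∀ x, g x = ∫ ω, h (M.X t ω) ∂(M.P x)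

/-- The first exit time `inf {t ≥ 0 : X(t) ∉ O}`, equal to `⊤` if there is no such `t`. -/
noncomputable def exitTime (O : Set E) : Ω → WithTop ℝ≥0 :=
  hittingAfter M.X Oᶜ 0

/-- For every `t > 0`, the operator `h ↦ (x ↦ 𝔼ˣ[1_{t < τ_O} h(X(t))])` maps the space of
bounded continuous functions into itself. -/
def StoppedFeller (O : Set E) : Prop :=
  ∀ t : ℝ≥0, 0 < t → ∀ h : E →ᵇ ℝ, ∃ g : E →ᵇ ℝ,
    ∀ x, g x = ∫ ω, Set.indicator {ω' | (t : WithTop ℝ≥0) < M.exitTime O ω'}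
      (fun ω' => h (M.X t ω')) ω ∂(M.P x)

/-- The pathwise running payoff `∫₀^{τ_O} e^{-γ u} g(s + u, X(u)) du`. -/
noncomputable def runningPayoff (O : Set E) (γ : ℝ) (g : ℝ≥0 × E → ℝ) (s : ℝ≥0) (ω : Ω) : ℝ :=
  ∫ u in {u : ℝ | 0 ≤ u ∧ (u.toNNReal : WithTop ℝ≥0) < M.exitTime O ω},
    Real.exp (-γ * u) * g (s + u.toNNReal, M.X u.toNNReal ω)

open scoped Classical in
/-- The pathwise exit payoff `e^{-γ τ_O} h(s + τ_O, X(τ_O))`, equal to `0` on `{τ_O = ∞}`. -/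
noncomputable def exitPayoff (O : Set E) (γ : ℝ) (h : ℝ≥0 × E → ℝ) (s : ℝ≥0) (ω : Ω) : ℝ :=
  if M.exitTime O ω = ⊤ then 0
  else Real.exp (-γ * ((M.exitTime O ω).untopA : ℝ≥0)) *
    h (s + (M.exitTime O ω).untopA, stoppedValue M.X (M.exitTime O) ω)

/-- `(s, x) ↦ 𝔼ˣ[∫₀^{τ_O} e^{-γ u} g(s + u, X(u)) du + e^{-γ τ_O} h(s + τ_O, X(τ_O))]`. -/
noncomputable def expectedPayoff (O : Set E) (γ : ℝ) (g h : ℝ≥0 × E → ℝ) : ℝ≥0 × E → ℝ :=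
  fun p => ∫ ω, (M.runningPayoff O γ g p.1 ω + M.exitPayoff O γ h p.1 ω) ∂(M.P p.2)

/-- `w` solves the penalized equation
`w(s,x) = 𝔼ˣ[∫₀^{τ_O} e^{-α u} [f + β (G - w)⁺](s + u, X(u)) du + e^{-α τ_O} H(s + τ_O, X(τ_O))]`. -/
def SolvesPenalized (O : Set E) (α β : ℝ) (f G H w : ℝ≥0 × E → ℝ) : Prop :=
  ∀ p, w p = M.expectedPayoff O α (fun q => f q + β * max (G q - w q) 0) H p

/-- The operator `𝒯φ(s,x) = 𝔼ˣ[∫₀^{τ_O} e^{-(α+β) u} [f + β (G - φ)⁺ + β φ](s + u, X(u)) du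
+ e^{-(α+β) τ_O} H(s + τ_O, X(τ_O))]`. -/
noncomputable def penaltyOperator (O : Set E) (α β : ℝ) (f G H φ : ℝ≥0 × E → ℝ) :
    ℝ≥0 × E → ℝ :=
  M.expectedPayoff O (α + β) (fun q => f q + β * max (G q - φ q) 0 + β * φ q) H

end StandardMarkovProcess

/-- Bounded Borel measurable real functions. -/
def BoundedMeasurable {S : Type*} [MeasurableSpace S] (φ : S → ℝ) : Prop :=
  Measurable φ ∧ ∃ C, ∀ p, |φ p| ≤ C

/-! Write `V_γ(g, h)` for the expected payoff with discount rate `γ`, running reward `g` and exit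
reward `h`. The Markov property gives a resolvent identity (`value_eq_value_add`): `V_α(g, h) =
V_γ(g + (γ - α) V_α(g, h), h)`. With `γ = α + β` it turns a solution of the penalized equation into
a fixed point of `𝒯`. Conversely, if `w` is a fixed point and `g = f + β (G - w)⁺` is frozen, then
`w` and `V_α(g, H)` are both fixed points of the contraction `u ↦ V_{α+β}(g + β u, H)`, so they
agree (`solvesPenalized_iff`). Since `(G - φ)⁺ + φ = max(G, φ)` is 1-Lipschitz in `φ` and
`e^{-(α+β)u} du` has mass `1/(α+β)`, `𝒯` contracts with constant `β/(α+β)`. Banach's theorem on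
bounded continuous functions gives existence; the same estimate on bounded measurable functions
gives uniqueness.

The work lies in measurability and continuity. For measurability, payoffs are treated as functionals
on path space, where the laws form a kernel (`pathLaw`). The exit time is replaced by the limit of
the hitting times of shrinking open neighbourhoods of the complement of `O`. This is measurable in
the path, and by quasi-left-continuity it is almost surely the exit time (`exitTime_ae_eq`).

For continuity (`continuous_value_of_feller`), the running part follows from (A1) and dominated
convergence. For the exit part, let `μ_x` be the discounted law of `(τ, X(τ))` and `U_γ` the
potential of the unstopped space-time process. The strong Markov property at `τ` gives `∫ U_γψ dμ_x
= U_γψ(0, x) - V_γ(ψ, 0)(0, x)` (`value_exit_potential`), which is continuous in `x`. The choice `ψ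
= γ` shows that the mass of `μ_x` is continuous. The functions `n U_{γ+n}k` are again `γ`-potentials
and converge boundedly to `k`, so by vague compactness `μ_x` is vaguely continuous. Together the two
facts give weak continuity. -/

open ProbabilityTheory
open scoped ENNReal CompactlySupported

/-! ### Hitting and exit times on path space -/

/-- Right-continuous paths indexed by `[0, ∞)`, with the σ-algebra generated by the evaluations. -/
abbrev RCPath (E : Type*) [TopologicalSpace E] :=
  {p : ℝ≥0 → E // ∀ t, ContinuousWithinAt p (Set.Ici t) t}

namespace RCPath

section Basic

variable {E : Type*} [TopologicalSpace E]

/-- The path `t ↦ p (u + t)`. -/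
def shift (u : ℝ≥0) (p : RCPath E) : RCPath E :=
  ⟨fun t => p.1 (u + t), fun t => by
    refine (p.2 (u + t)).comp (f := fun t => u + t) (by fun_prop) ?_
    intro s hs
    simpa using hs⟩

@[simp] lemma shift_apply (u : ℝ≥0) (p : RCPath E) (t : ℝ≥0) : (shift u p).1 t = p.1 (u + t) := rfl

/-- The first hitting time of `U`. -/
noncomputable def hit (U : Set E) (p : RCPath E) : ℝ≥0∞ :=
  ⨅ t : ℝ≥0, ⨅ _ : p.1 t ∈ U, (t : ℝ≥0∞)

lemma hit_lt_iff {U : Set E} {p : RCPath E} {c : ℝ≥0∞} :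
    hit U p < c ↔ ∃ t : ℝ≥0, p.1 t ∈ U ∧ (t : ℝ≥0∞) < c := by
  simp [hit, iInf_lt_iff]

lemma hit_le {U : Set E} {p : RCPath E} {t : ℝ≥0} (h : p.1 t ∈ U) : hit U p ≤ t :=
  iInf₂_le t h

lemma hit_anti {U V : Set E} (h : U ⊆ V) (p : RCPath E) : hit V p ≤ hit U p :=
  le_iInf₂ fun _ ht => hit_le (h ht)

/-- A right-continuous path that is in an open set stays there for a short time, and the strict
inequality leaves room for it, so a visit at a time of a countable dense set can be found. This is
the source of all measurability of hitting times. -/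
lemma hit_lt_iff_of_isOpen {U : Set E} (hU : IsOpen U) {p : RCPath E} {c : ℝ≥0∞} :
    hit U p < c ↔
      ∃ n, (TopologicalSpace.denseSeq ℝ≥0 n : ℝ≥0∞) < c ∧
        p.1 (TopologicalSpace.denseSeq ℝ≥0 n) ∈ U := by
  rw [hit_lt_iff]
  constructor
  · rintro ⟨t, ht, htc⟩
    have h1 : ∀ᶠ s in 𝓝[>] t, p.1 s ∈ U :=
      ((p.2 t).mono Set.Ioi_subset_Ici_self).eventually (hU.mem_nhds ht)
    have h2 : ∀ᶠ s : ℝ≥0 in 𝓝[>] t, (s : ℝ≥0∞) < c :=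
      nhdsWithin_le_nhds
        (ENNReal.continuous_coe.continuousAt.eventually (isOpen_Iio.mem_nhds htc))
    obtain ⟨d, hd, hsub⟩ := mem_nhdsGT_iff_exists_Ioo_subset.1 (h1.and h2)
    obtain ⟨n, hn⟩ := (TopologicalSpace.denseRange_denseSeq ℝ≥0).exists_mem_open
      isOpen_Ioo (Set.nonempty_Ioo.2 hd)
    exact ⟨n, (hsub hn).2, (hsub hn).1⟩
  · rintro ⟨n, hn, hnU⟩
    exact ⟨_, hnU, hn⟩

lemma hit_eq_add_hit_shift {U : Set E} {p : RCPath E} {u : ℝ≥0} (hu : (u : ℝ≥0∞) ≤ hit U p) :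
    hit U p = u + hit U (shift u p) := by
  apply le_antisymm
  · simp only [hit]
    rw [ENNReal.add_iInf]
    refine le_iInf fun t => ?_
    by_cases ht : p.1 (u + t) ∈ U
    · have := hit_le ht
      simp only [shift_apply, ht, iInf_pos]
      exact_mod_cast this
    · simp [ht]
  · refine le_iInf₂ fun t ht => ?_
    have hut : u ≤ t := by exact_mod_cast hu.trans (hit_le ht)
    have h : (shift u p).1 (t - u) ∈ U := by simpa [add_tsub_cancel_of_le hut] using ht
    calc (u : ℝ≥0∞) + hit U (shift u p) ≤ u + ((t - u : ℝ≥0) : ℝ≥0∞) := by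
          gcongr; exact hit_le h
      _ = t := by rw [← ENNReal.coe_add, add_tsub_cancel_of_le hut]

/-- At the hitting time, the path is in the closure of the target. -/
lemma mem_closure_of_hit_eq {U : Set E} {p : RCPath E} {t : ℝ≥0} (h : hit U p = t) :
    p.1 t ∈ closure U := by
  rw [mem_closure_iff_nhds]
  intro V hV
  obtain ⟨d, hd, hsub⟩ := mem_nhdsGE_iff_exists_Ico_subset.1 (p.2 t hV)
  obtain ⟨s, hs, hsd⟩ := hit_lt_iff.1 (h.trans_lt (ENNReal.coe_lt_coe.2 hd))
  have hts : t ≤ s := by exact_mod_cast h.symm.trans_le (hit_le hs)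
  exact ⟨p.1 s, hsub ⟨hts, by exact_mod_cast hsd⟩, hs⟩

variable [MeasurableSpace E]

lemma measurable_eval (t : ℝ≥0) : Measurable fun p : RCPath E => p.1 t :=
  (measurable_pi_apply t).comp measurable_subtype_coe

lemma measurable_shift (u : ℝ≥0) : Measurable (shift u : RCPath E → RCPath E) :=
  Measurable.subtype_mk (measurable_pi_lambda _ fun t => measurable_eval (u + t))

lemma measurable_hit [OpensMeasurableSpace E] {U : Set E} (hU : IsOpen U) :
    Measurable (hit U) := by
  refine measurable_of_Iio fun c => ?_
  have : hit U ⁻¹' Set.Iio c = ⋃ n, {p : RCPath E |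
      (TopologicalSpace.denseSeq ℝ≥0 n : ℝ≥0∞) < c ∧
        p.1 (TopologicalSpace.denseSeq ℝ≥0 n) ∈ U} := by
    ext p
    simp [hit_lt_iff_of_isOpen hU]
  rw [this]
  refine MeasurableSet.iUnion fun n => ?_
  by_cases h : (TopologicalSpace.denseSeq ℝ≥0 n : ℝ≥0∞) < c
  · simp only [h, true_and]
    exact (measurable_eval _) hU.measurableSet
  · simp [h]

end Basic

section Metric

variable {E : Type*} [MetricSpace E]

/-- The smallest multiple of `1 / (k + 1)` that exceeds `t`. -/
noncomputable def gridAbove (k : ℕ) (t : ℝ≥0) : ℝ≥0 := (⌊t * (k + 1)⌋₊ + 1 : ℝ≥0) / (k + 1)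

lemma lt_gridAbove (k : ℕ) (t : ℝ≥0) : t < gridAbove k t := by
  rw [gridAbove, lt_div_iff₀ (by positivity)]
  exact Nat.lt_floor_add_one _

lemma gridAbove_le (k : ℕ) (t : ℝ≥0) : gridAbove k t ≤ t + 1 / (k + 1) := by
  rw [gridAbove, div_le_iff₀ (by positivity), add_mul, one_div, inv_mul_cancel₀ (by positivity)]
  gcongr
  exact Nat.floor_le (by positivity)

lemma tendsto_gridAbove (t : ℝ≥0) :
    Tendsto (fun k => gridAbove k t) atTop (𝓝[≥] t) := by
  refine tendsto_nhdsWithin_iff.2 ⟨?_, Eventually.of_forall fun k => (lt_gridAbove k t).le⟩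
  refine tendsto_of_tendsto_of_tendsto_of_le_of_le tendsto_const_nhds ?_
    (fun k => (lt_gridAbove k t).le) (fun k => gridAbove_le k t)
  have : Tendsto (fun k : ℕ => 1 / ((k : ℝ≥0) + 1)) atTop (𝓝 0) :=
    tendsto_one_div_add_atTop_nhds_zero_nat
  simpa using this.const_add t

lemma monotone_hit_thickening (O : Set E) (p : RCPath E) :
    Monotone fun n : ℕ => hit (Metric.thickening (1 / (n + 1 : ℝ)) Oᶜ) p :=
  fun m n h => hit_anti (Metric.thickening_mono (by gcongr) _) p

/-- The exit time from `O`, as the limit of the hitting times of neighbourhoods of `Oᶜ`. -/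
noncomputable def exit (O : Set E) (p : RCPath E) : ℝ≥0∞ :=
  ⨆ n : ℕ, hit (Metric.thickening (1 / (n + 1 : ℝ)) Oᶜ) p

/-- If `u` is strictly before the limit, then it is before all but finitely many of the
approximating hitting times, and each of these is additive under the shift. At `u = exit O p` this
can fail: the path may approach the complement of `O` from the left and then jump back into `O`. -/
lemma exit_eq_add_exit_shift {O : Set E} {p : RCPath E} {u : ℝ≥0} (hu : (u : ℝ≥0∞) < exit O p) :
    exit O p = u + exit O (shift u p) := by
  obtain ⟨n, hn⟩ := lt_iSup_iff.1 hu
  rw [exit, exit, ← (monotone_hit_thickening O p).iSup_nat_add n,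
    ← (monotone_hit_thickening O (shift u p)).iSup_nat_add n, ENNReal.add_iSup]
  refine iSup_congr fun m => hit_eq_add_hit_shift (hn.le.trans ?_)
  exact monotone_hit_thickening O p (Nat.le_add_left n m)

variable [MeasurableSpace E] [BorelSpace E]

/-- Right-continuity makes evaluation the limit of evaluations at grid times strictly to the right;
each of those involves only countably many times. -/
lemma measurable_eval_prod : Measurable fun q : ℝ≥0 × RCPath E => q.2.1 q.1 := by
  refine measurable_of_tendsto_metrizable (f := fun k q => q.2.1 (gridAbove k q.1)) (fun k => ?_)
    (tendsto_pi_nhds.2 fun q => (q.2.2 q.1).tendsto.comp (tendsto_gridAbove q.1))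
  have h1 : Measurable fun r : ℕ × RCPath E => r.2.1 ((r.1 + 1 : ℝ≥0) / (k + 1)) :=
    measurable_from_prod_countable_right fun n => measurable_eval ((n + 1 : ℝ≥0) / (k + 1))
  exact h1.comp ((Nat.measurable_floor.comp (measurable_fst.mul_const _)).prodMk measurable_snd)

lemma measurable_exit (O : Set E) : Measurable (exit O) :=
  Measurable.iSup fun _ => measurable_hit Metric.isOpen_thickening

end Metric

end RCPath

/-! ### The exit time of the process as a functional of its path -/

namespace StandardMarkovProcess

section Path

variable {E : Type*} [TopologicalSpace E] [MeasurableSpace E]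
  {Ω : Type*} [MeasurableSpace Ω] (M : StandardMarkovProcess E Ω)

/-- The path of the process. -/
def path (ω : Ω) : RCPath E := ⟨fun t => M.X t ω, M.rightContinuous ω⟩

lemma measurable_X (t : ℝ≥0) : Measurable (M.X t) := (M.adapted t).mono (M.F.le t) le_rfl

lemma measurable_path : Measurable M.path :=
  Measurable.subtype_mk (measurable_pi_lambda _ fun t => M.measurable_X t)

@[simp] lemma path_apply (ω : Ω) (t : ℝ≥0) : (M.path ω).1 t = M.X t ω := rfl

/-- The hitting time of `U` as a random time. -/
noncomputable def hitTime (U : Set E) : Ω → WithTop ℝ≥0 := fun ω => RCPath.hit U (M.path ω)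

lemma hitTime_lt_coe_iff {U : Set E} {ω : Ω} {c : ℝ≥0} :
    M.hitTime U ω < c ↔ RCPath.hit U (M.path ω) < c := Iff.rfl

lemma stoppedValue_of_eq_coe {τ : Ω → WithTop ℝ≥0} {ω : Ω} {t : ℝ≥0} (h : τ ω = t) :
    stoppedValue M.X τ ω = M.X t ω := by
  rw [stoppedValue, h]
  rfl

/-- Only the events `{hit < c}` are visibly in `𝓕_c`; right-continuity of the filtration then yields
the stopping time property. -/
lemma isStoppingTime_hit [OpensMeasurableSpace E] {U : Set E} (hU : IsOpen U) :
    IsStoppingTime M.F (M.hitTime U) := by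
  have := M.filtration_rightContinuous
  refine isStoppingTime_of_measurableSet_lt_of_isRightContinuous fun c => ?_
  have : {ω | M.hitTime U ω < c} =
      ⋃ n, {ω | TopologicalSpace.denseSeq ℝ≥0 n < c ∧
        M.X (TopologicalSpace.denseSeq ℝ≥0 n) ω ∈ U} := by
    ext ω
    have h := RCPath.hit_lt_iff_of_isOpen hU (p := M.path ω) (c := (c : ℝ≥0∞))
    simp only [ENNReal.coe_lt_coe] at h
    exact (M.hitTime_lt_coe_iff.trans h).trans (by simp)
  rw [this]
  refine MeasurableSet.iUnion fun n => ?_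
  by_cases h : TopologicalSpace.denseSeq ℝ≥0 n < c
  · simp only [h, true_and]
    exact M.F.mono h.le _ (M.adapted _ hU.measurableSet)
  · simp [h]

end Path

section Exit

variable {E : Type*} [MetricSpace E] [MeasurableSpace E]
  {Ω : Type*} [MeasurableSpace Ω] (M : StandardMarkovProcess E Ω)

/-- The exit time from `O` as the limit of hitting times of neighbourhoods of `Oᶜ`. -/
noncomputable def exitLimit (O : Set E) : Ω → WithTop ℝ≥0 := fun ω => RCPath.exit O (M.path ω)

lemma exitLimit_le_coe_iff {O : Set E} {ω : Ω} {c : ℝ≥0} :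
    M.exitLimit O ω ≤ c ↔ RCPath.exit O (M.path ω) ≤ c := Iff.rfl

lemma exitLimit_eq_coe_iff {O : Set E} {ω : Ω} {c : ℝ≥0} :
    M.exitLimit O ω = c ↔ RCPath.exit O (M.path ω) = c := Iff.rfl

lemma exitLimit_eq_top_iff {O : Set E} {ω : Ω} :
    M.exitLimit O ω = ⊤ ↔ RCPath.exit O (M.path ω) = ⊤ := Iff.rfl

lemma coe_lt_exitLimit_iff {O : Set E} {ω : Ω} {c : ℝ≥0} :
    c < M.exitLimit O ω ↔ (c : ℝ≥0∞) < RCPath.exit O (M.path ω) := Iff.rfl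

lemma isStoppingTime_exitLimit [BorelSpace E] (O : Set E) : IsStoppingTime M.F (M.exitLimit O) := by
  intro c
  have : {ω | M.exitLimit O ω ≤ c} = ⋂ n : ℕ,
      {ω | M.hitTime (Metric.thickening (1 / (n + 1 : ℝ)) Oᶜ) ω ≤ c} := by
    ext ω
    simp only [Set.mem_iInter]
    exact iSup_le_iff (α := ℝ≥0∞)
  rw [this]
  exact MeasurableSet.iInter fun n => M.isStoppingTime_hit Metric.isOpen_thickening c

lemma exit_path_le {O : Set E} {ω : Ω} {t : ℝ≥0} (h : M.X t ω ∉ O) :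
    RCPath.exit O (M.path ω) ≤ t :=
  iSup_le fun n => RCPath.hit_le (Metric.self_subset_thickening (by positivity) _ h)

/-- No exit can precede the limit of the neighbourhood hitting times. The only possible discrepancy
is that the path is still in `O` at a finite limit time, which the hypothesis excludes. -/
lemma exitTime_eq_exitLimit {O : Set E} {ω : Ω}
    (h : ∀ t : ℝ≥0, M.exitLimit O ω = t → M.X t ω ∉ O) :
    M.exitTime O ω = M.exitLimit O ω := by
  have hle : ∀ t : ℝ≥0, M.X t ω ∉ O → M.exitLimit O ω ≤ t := fun t => M.exit_path_le
  rw [exitTime, hittingAfter]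
  split_ifs with hj
  · obtain ⟨j, hj⟩ := hj
    have hlt : M.exitLimit O ω ≠ ⊤ := ((hle j hj.2).trans_lt (WithTop.coe_lt_top j)).ne
    obtain ⟨t, ht⟩ := WithTop.ne_top_iff_exists.1 hlt
    rw [← ht, WithTop.coe_inj]
    apply le_antisymm
    · exact csInf_le (OrderBot.bddBelow _) ⟨zero_le, h t ht.symm⟩
    · refine le_csInf ⟨j, hj⟩ fun s hs => ?_
      have := hle s hs.2
      rw [← ht] at this
      exact_mod_cast this
  · by_contra hne
    obtain ⟨t, ht⟩ := WithTop.ne_top_iff_exists.1 (Ne.symm hne)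
    exact hj ⟨t, zero_le, h t ht.symm⟩

/-- At the `n`-th hitting time the path is within `1/(n+1)` of the complement of `O`.
Quasi-left-continuity passes this to the limit time, where the distance is therefore zero, and the
complement is closed. -/
lemma exitTime_ae_eq [BorelSpace E] {O : Set E} (hO : IsOpen O) (x : E) :
    ∀ᵐ ω ∂(M.P x), M.exitTime O ω = M.exitLimit O ω := by
  have h := M.quasiLeftContinuous
    (fun n => M.hitTime (Metric.thickening (1 / (n + 1 : ℝ)) Oᶜ)) (M.exitLimit O)
    (fun n => M.isStoppingTime_hit Metric.isOpen_thickening)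
    (fun m n hmn ω => RCPath.monotone_hit_thickening O (M.path ω) hmn)
    (fun ω => isLUB_iSup (α := ℝ≥0∞)) x
  filter_upwards [h] with ω hω
  refine M.exitTime_eq_exitLimit fun t ht => ?_
  have hlim := hω (by rw [ht]; exact WithTop.coe_lt_top t)
  rw [M.stoppedValue_of_eq_coe ht] at hlim
  have hle : ∀ n : ℕ, Metric.infEDist (stoppedValue M.X
      (M.hitTime (Metric.thickening (1 / (n + 1 : ℝ)) Oᶜ)) ω) Oᶜ ≤
        ENNReal.ofReal (1 / (n + 1 : ℝ)) := by
    intro n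
    have hn : M.hitTime (Metric.thickening (1 / (n + 1 : ℝ)) Oᶜ) ω ≠ ⊤ := by
      refine (lt_of_le_of_lt ?_ (ht.trans_lt (WithTop.coe_lt_top t))).ne
      exact le_iSup (fun n : ℕ => RCPath.hit (Metric.thickening (1 / (n + 1 : ℝ)) Oᶜ) (M.path ω)) n
    obtain ⟨r, hr⟩ := WithTop.ne_top_iff_exists.1 hn
    have h1 := RCPath.mem_closure_of_hit_eq (p := M.path ω) (t := r) hr.symm
    rw [M.stoppedValue_of_eq_coe hr.symm]
    exact Metric.closure_thickening_subset_cthickening _ _ h1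
  have h0 : Tendsto (fun n : ℕ => ENNReal.ofReal (1 / (n + 1 : ℝ))) atTop (𝓝 0) := by
    have := (ENNReal.continuous_ofReal.tendsto 0).comp
      (tendsto_one_div_add_atTop_nhds_zero_nat (𝕜 := ℝ))
    rwa [ENNReal.ofReal_zero] at this
  have h1 := (Metric.continuous_infEDist (s := Oᶜ)).continuousAt.tendsto.comp hlim
  have h2 : Metric.infEDist (M.X t ω) Oᶜ = 0 :=
    le_antisymm (le_of_tendsto_of_tendsto' h1 h0 hle) zero_le
  have h3 := Metric.mem_closure_iff_infEDist_zero.2 h2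
  rwa [hO.isClosed_compl.closure_eq] at h3

end Exit

end StandardMarkovProcess

/-! ### The path law as a kernel and the Markov property on path space -/

/-- Finite-dimensional rectangles in path space. -/
def RCPath.rectangles (E : Type*) [TopologicalSpace E] [MeasurableSpace E] :
    Set (Set (RCPath E)) :=
  {S | ∃ t ∈ squareCylinders (fun _ : ℝ≥0 => {s : Set E | MeasurableSet s}),
    Subtype.val ⁻¹' t = S}

lemma RCPath.isPiSystem_rectangles (E : Type*) [TopologicalSpace E] [MeasurableSpace E] :
    IsPiSystem (RCPath.rectangles E) :=
  (isPiSystem_squareCylinders (fun _ => MeasurableSpace.isPiSystem_measurableSet)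
    (fun _ => MeasurableSet.univ)).comap _

lemma RCPath.generateFrom_rectangles (E : Type*) [TopologicalSpace E] [MeasurableSpace E] :
    Subtype.instMeasurableSpace = MeasurableSpace.generateFrom (RCPath.rectangles E) := by
  rw [Subtype.instMeasurableSpace, ← generateFrom_squareCylinders,
    MeasurableSpace.comap_generateFrom]
  rfl

lemma RCPath.mem_rectangles {E : Type*} [TopologicalSpace E] [MeasurableSpace E]
    {S : Set (RCPath E)} (hS : S ∈ RCPath.rectangles E) :
    ∃ (s : Finset ℝ≥0) (B : ℝ≥0 → Set E), (∀ i, MeasurableSet (B i)) ∧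
      S = {p | ∀ i ∈ s, p.1 i ∈ B i} := by
  obtain ⟨t, ⟨s, B, hB, rfl⟩, rfl⟩ := hS
  exact ⟨s, B, fun i => hB i (Set.mem_univ i), rfl⟩

namespace StandardMarkovProcess

variable {E : Type*} [TopologicalSpace E] [MeasurableSpace E]
  {Ω : Type*} [MeasurableSpace Ω] (M : StandardMarkovProcess E Ω)

instance (x : E) : IsProbabilityMeasure (M.P x) := M.isProbabilityMeasure x

/-- The transition kernel `Pₜ(x, ·)`. -/
noncomputable def transition (t : ℝ≥0) : Kernel E E where
  toFun x := (M.P x).map (M.X t)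
  measurable' := Measure.measurable_of_measurable_coe _ fun B hB => by
    simp_rw [Measure.map_apply (M.measurable_X t) hB]
    exact M.measurable_transition t B hB

lemma transition_apply (t : ℝ≥0) (x : E) : M.transition t x = (M.P x).map (M.X t) := rfl

instance (t : ℝ≥0) : IsMarkovKernel (M.transition t) :=
  ⟨fun _ => Measure.isProbabilityMeasure_map (M.measurable_X t).aemeasurable⟩

lemma markov_apply (u d : ℝ≥0) (x : E) {A : Set Ω} (hA : MeasurableSet[M.F u] A) {B : Set E}
    (hB : MeasurableSet B) :
    M.P x (A ∩ {ω | M.X (u + d) ω ∈ B}) = ∫⁻ ω in A, M.transition d (M.X u ω) B ∂(M.P x) := by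
  have h := M.strongMarkov (fun _ => (u : WithTop ℝ≥0)) (isStoppingTime_const M.F u) d B hB x A
    (by rwa [IsStoppingTime.measurableSpace_const])
  have h1 : ∀ ω : Ω, stoppedValue M.X (fun _ => (u : WithTop ℝ≥0)) ω = M.X u ω := fun _ => rfl
  have h2 : ∀ ω : Ω, stoppedValue M.X (fun _ => (u : WithTop ℝ≥0) + d) ω = M.X (u + d) ω :=
    fun _ => rfl
  simp only [WithTop.coe_lt_top, Set.ofPred_true, Set.inter_univ, h1, h2] at h
  rw [h]
  simp_rw [transition_apply, Measure.map_apply (M.measurable_X d) hB]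

lemma map_X_add (u d : ℝ≥0) (x : E) {A : Set Ω} (hA : MeasurableSet[M.F u] A) :
    ((M.P x).restrict A).map (M.X (u + d)) =
      (((M.P x).restrict A).map (M.X u)).bind (M.transition d) := by
  ext B hB
  rw [Measure.map_apply (M.measurable_X _) hB,
    Measure.restrict_apply (M.measurable_X _ hB), Set.inter_comm,
    Measure.bind_apply hB (M.transition d).aemeasurable,
    lintegral_map ((M.transition d).measurable_coe hB) (M.measurable_X u)]
  exact M.markov_apply u d x hA hB

lemma lintegral_X_add (u d : ℝ≥0) (x : E) {A : Set Ω} (hA : MeasurableSet[M.F u] A)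
    {f : E → ℝ≥0∞} (hf : Measurable f) :
    ∫⁻ ω in A, f (M.X (u + d) ω) ∂(M.P x) =
      ∫⁻ ω in A, ∫⁻ z, f z ∂(M.transition d (M.X u ω)) ∂(M.P x) := by
  rw [← lintegral_map hf (M.measurable_X _), M.map_X_add u d x hA,
    Measure.lintegral_bind (M.transition d).aemeasurable hf.aemeasurable,
    lintegral_map hf.lintegral_kernel (M.measurable_X u)]

/-- The Markov property for finite-dimensional rectangles, with an unspecified kernel. -/
lemma exists_rectangle_prob {B : ℝ≥0 → Set E} (hB : ∀ i, MeasurableSet (B i))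
    (s : Finset ℝ≥0) : ∀ r, (∀ i ∈ s, r ≤ i) → ∃ p : E → ℝ≥0∞, Measurable p ∧
      ∀ u x (A : Set Ω), MeasurableSet[M.F (u + r)] A →
        M.P x (A ∩ {ω | ∀ i ∈ s, M.X (u + i) ω ∈ B i}) =
          ∫⁻ ω in A, p (M.X (u + r) ω) ∂(M.P x) := by
  -- Peel off the earliest time `a`: the condition at `a` is absorbed into the event `A`, the later
  -- times are handled by induction from `a`, and one transition of length `a - r` returns to `r`.
  -- The function `p` is chosen before `u`, `x` and `A`, so that it can be identified later at `u =
  -- 0`.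
  induction s using Finset.induction_on_min with
  | empty =>
    refine fun r _ => ⟨fun _ => 1, measurable_const, fun u x A hA => ?_⟩
    simp
  | insert a s has ih =>
    intro r hr
    obtain ⟨p, hp, hps⟩ := ih a fun i hi => (has i hi).le
    have hra : r ≤ a := hr a (Finset.mem_insert_self a s)
    have hf : Measurable ((B a).indicator p) := hp.indicator (hB a)
    refine ⟨fun z => ∫⁻ y, (B a).indicator p y ∂(M.transition (a - r) z),
      hf.lintegral_kernel, fun u x A hA => ?_⟩
    have hua : u + r + (a - r) = u + a := by rw [add_assoc, add_tsub_cancel_of_le hra]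
    have hXa : MeasurableSet[M.F (u + a)] {ω | M.X (u + a) ω ∈ B a} := M.adapted _ (hB a)
    have hA' : MeasurableSet[M.F (u + a)] (A ∩ {ω | M.X (u + a) ω ∈ B a}) :=
      (M.F.mono (by gcongr) _ hA).inter hXa
    have hset : A ∩ {ω | ∀ i ∈ insert a s, M.X (u + i) ω ∈ B i} =
        (A ∩ {ω | M.X (u + a) ω ∈ B a}) ∩ {ω | ∀ i ∈ s, M.X (u + i) ω ∈ B i} := by
      ext ω
      simp [and_assoc]
    rw [hset, hps u x _ hA', ← M.lintegral_X_add (u + r) (a - r) x hA hf, hua, Set.inter_comm,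
      ← Measure.restrict_restrict (M.F.le _ _ hXa), ← lintegral_indicator (M.F.le _ _ hXa)]
    rfl

lemma exists_path_rectangle_prob {S : Set (RCPath E)} (hS : S ∈ RCPath.rectangles E) :
    ∃ p : E → ℝ≥0∞, Measurable p ∧ ∀ u x (A : Set Ω), MeasurableSet[M.F u] A →
      M.P x (A ∩ {ω | (M.path ω).shift u ∈ S}) = ∫⁻ ω in A, p (M.X u ω) ∂(M.P x) := by
  obtain ⟨s, B, hB, rfl⟩ := RCPath.mem_rectangles hS
  obtain ⟨p, hp, h⟩ := M.exists_rectangle_prob hB s 0 (fun _ _ => zero_le)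
  refine ⟨p, hp, fun u x A hA => ?_⟩
  have := h u x A (by rwa [add_zero])
  rwa [add_zero] at this

/-- At `u = 0` the process sits at its starting point, so the integral collapses to `p x`. Hence the
unspecified `p` is the path probability, which gives both its measurability in `x` and the right
kernel in the Markov property. -/
lemma path_prob_eq {S : Set (RCPath E)} {p : E → ℝ≥0∞}
    (h : ∀ u x (A : Set Ω), MeasurableSet[M.F u] A →
      M.P x (A ∩ {ω | (M.path ω).shift u ∈ S}) = ∫⁻ ω in A, p (M.X u ω) ∂(M.P x)) (x : E) :
    M.P x (M.path ⁻¹' S) = p x := by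
  have h0 := h 0 x Set.univ MeasurableSet.univ
  have h1 : ∀ ω, (M.path ω).shift 0 = M.path ω := fun ω => by ext t; simp
  simp only [Set.univ_inter, h1, Measure.restrict_univ] at h0
  have h2 : ∫⁻ ω, p (M.X 0 ω) ∂(M.P x) = ∫⁻ _, p x ∂(M.P x) :=
    lintegral_congr_ae ((M.start x).mono fun ω hω => by simp only [hω])
  rw [h2, lintegral_const, measure_univ, mul_one] at h0
  exact h0

lemma measurableSet_of_mem_rectangles {S : Set (RCPath E)} (hS : S ∈ RCPath.rectangles E) :
    MeasurableSet S := by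
  rw [RCPath.generateFrom_rectangles]
  exact MeasurableSpace.measurableSet_generateFrom hS

/-- The law of the path started at `x`. -/
noncomputable def pathLaw : Kernel E (RCPath E) where
  toFun x := (M.P x).map M.path
  measurable' := by
    have : ∀ x, IsProbabilityMeasure ((M.P x).map M.path) := fun x =>
      Measure.isProbabilityMeasure_map M.measurable_path.aemeasurable
    refine Measurable.measure_of_isPiSystem_of_isProbabilityMeasure
      (RCPath.generateFrom_rectangles E) (RCPath.isPiSystem_rectangles E) fun S hS => ?_
    obtain ⟨p, hp, h⟩ := M.exists_path_rectangle_prob hS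
    have : (fun x => (M.P x).map M.path S) = p := by
      ext x
      rw [Measure.map_apply M.measurable_path (measurableSet_of_mem_rectangles hS),
        M.path_prob_eq h x]
    rwa [this]

lemma pathLaw_apply (x : E) : M.pathLaw x = (M.P x).map M.path := rfl

instance : IsMarkovKernel M.pathLaw :=
  ⟨fun _ => Measure.isProbabilityMeasure_map M.measurable_path.aemeasurable⟩

/-- The Markov property on path space. -/
lemma map_shift_path (u : ℝ≥0) (x : E) {A : Set Ω} (hA : MeasurableSet[M.F u] A) :
    ((M.P x).restrict A).map (fun ω => (M.path ω).shift u) =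
      (((M.P x).restrict A).map (M.X u)).bind M.pathLaw := by
  have hm : Measurable fun ω => (M.path ω).shift u :=
    (RCPath.measurable_shift u).comp M.measurable_path
  refine ext_of_generate_finite _ (RCPath.generateFrom_rectangles E)
    (RCPath.isPiSystem_rectangles E) (fun S hS => ?_) ?_
  · have hSm := measurableSet_of_mem_rectangles hS
    obtain ⟨p, hp, h⟩ := M.exists_path_rectangle_prob hS
    rw [Measure.map_apply hm hSm, Measure.restrict_apply (hm hSm), Set.inter_comm,
      Measure.bind_apply hSm M.pathLaw.aemeasurable,
      lintegral_map (M.pathLaw.measurable_coe hSm) (M.measurable_X u)]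
    refine (h u x A hA).trans (lintegral_congr fun ω => ?_)
    rw [pathLaw_apply, Measure.map_apply M.measurable_path hSm, M.path_prob_eq h]
  · rw [Measure.map_apply hm MeasurableSet.univ,
      Measure.bind_apply MeasurableSet.univ M.pathLaw.aemeasurable]
    simp [Measure.map_apply (M.measurable_X u) MeasurableSet.univ]

end StandardMarkovProcess

/-! ### Discount measures and their resolvent identity -/

/-- The measure `e^{-γ u} du` on `[0, ∞)`. -/
noncomputable def discount (γ : ℝ) : Measure ℝ≥0 :=
  ((volume.restrict (Set.Ioi (0 : ℝ))).withDensity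
    fun u => ENNReal.ofReal (Real.exp (-γ * u))).map Real.toNNReal

lemma lintegral_discount (γ : ℝ) {F : ℝ≥0 → ℝ≥0∞} (hF : Measurable F) :
    ∫⁻ u, F u ∂(discount γ) =
      ∫⁻ u in Set.Ioi (0 : ℝ), ENNReal.ofReal (Real.exp (-γ * u)) * F u.toNNReal := by
  rw [discount, lintegral_map hF measurable_real_toNNReal,
    lintegral_withDensity_eq_lintegral_mul _ (by fun_prop)
      (show Measurable fun u : ℝ => F u.toNNReal from hF.comp measurable_real_toNNReal)]
  rfl

lemma integral_discount (γ : ℝ) {F : ℝ≥0 → ℝ} (hF : Measurable F) :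
    ∫ u, F u ∂(discount γ) =
      ∫ u in Set.Ioi (0 : ℝ), Real.exp (-γ * u) * F u.toNNReal := by
  rw [discount, integral_map measurable_real_toNNReal.aemeasurable hF.aestronglyMeasurable,
    integral_withDensity_eq_integral_toReal_smul (by fun_prop) (by simp)]
  simp [ENNReal.toReal_ofReal (Real.exp_nonneg _)]

lemma isFiniteMeasure_discount {γ : ℝ} (hγ : 0 < γ) : IsFiniteMeasure (discount γ) := by
  have h := (integrableOn_exp_mul_Ioi (neg_lt_zero.2 hγ) 0)
  have : IsFiniteMeasure ((volume.restrict (Set.Ioi (0 : ℝ))).withDensity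
      fun u => ENNReal.ofReal (Real.exp (-γ * u))) := isFiniteMeasure_withDensity_ofReal h.2
  exact Measure.isFiniteMeasure_map _ _

/-- Absence of atoms allows end points to be ignored, and also the time `0`, about which (A1) says
nothing. -/
instance (γ : ℝ) : NullSingletonClass (discount γ) where
  measure_singleton a := by
    rw [discount, Measure.map_apply measurable_real_toNNReal (measurableSet_singleton a)]
    refine withDensity_absolutelyContinuous _ _ ?_
    rw [Measure.restrict_apply (measurable_real_toNNReal (measurableSet_singleton a))]
    refine measure_mono_null (t := {(a : ℝ)}) ?_ (by simp)
    rintro u ⟨hu, hu0⟩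
    simp only [Set.mem_preimage, Set.mem_singleton_iff] at hu ⊢
    rw [← hu, Real.coe_toNNReal _ (le_of_lt hu0)]

lemma integral_discount_one {γ : ℝ} (hγ : 0 < γ) : ∫ _, (1 : ℝ) ∂(discount γ) = 1 / γ := by
  rw [integral_discount γ measurable_const]
  simp only [mul_one]
  rw [integral_exp_mul_Ioi (neg_lt_zero.2 hγ) 0]
  simp

/-- The image of `discount γ` under translation. -/
lemma smul_map_add_discount (γ : ℝ) (a : ℝ≥0) :
    ENNReal.ofReal (Real.exp (-γ * a)) • (discount γ).map (fun t => a + t) =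
      (discount γ).restrict (Set.Ioi a) := by
  ext S hS
  have hm : Measurable fun t : ℝ≥0 => a + t := by fun_prop
  rw [Measure.smul_apply, ← lintegral_indicator_one hS, ← lintegral_indicator_one hS,
    lintegral_map (by fun_prop (disch := exact hS)) hm, ← lintegral_indicator measurableSet_Ioi,
    lintegral_discount γ (show Measurable fun t => S.indicator (1 : ℝ≥0 → ℝ≥0∞) (a + t) from
      (measurable_one.indicator hS).comp hm),
    lintegral_discount γ ((measurable_one.indicator hS).indicator measurableSet_Ioi),
    smul_eq_mul, ← lintegral_const_mul' _ _ ENNReal.ofReal_ne_top,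
    ← lintegral_indicator measurableSet_Ioi, ← lintegral_indicator measurableSet_Ioi]
  conv_rhs => rw [← lintegral_add_left_eq_self _ (a : ℝ)]
  refine lintegral_congr fun u => ?_
  by_cases hu : 0 < u
  · have h1 : (a : ℝ) + u ∈ Set.Ioi (0 : ℝ) := add_pos_of_nonneg_of_pos a.2 hu
    have h2 : ((a : ℝ) + u).toNNReal = a + u.toNNReal := by
      rw [Real.toNNReal_add a.coe_nonneg hu.le, Real.toNNReal_coe]
    have h3 : a + u.toNNReal ∈ Set.Ioi a := by simpa using hu
    rw [Set.indicator_of_mem (Set.mem_Ioi.2 hu), Set.indicator_of_mem h1, h2,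
      Set.indicator_of_mem h3, ← mul_assoc, ← ENNReal.ofReal_mul (Real.exp_nonneg _),
      ← Real.exp_add]
    ring_nf
  · rw [Set.indicator_of_notMem (show u ∉ Set.Ioi (0 : ℝ) from hu)]
    by_cases h1 : (a : ℝ) + u ∈ Set.Ioi (0 : ℝ)
    · rw [Set.indicator_of_mem h1, Set.indicator_of_notMem, mul_zero]
      simp only [Set.mem_Ioi, not_lt]
      rw [Real.toNNReal_le_iff_le_coe]
      linarith
    · rw [Set.indicator_of_notMem h1]

lemma lintegral_discount_shift (γ : ℝ) (a : ℝ≥0) {F : ℝ≥0 → ℝ≥0∞} (hF : Measurable F) :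
    ENNReal.ofReal (Real.exp (-γ * a)) * ∫⁻ t, F (a + t) ∂(discount γ) =
      ∫⁻ u in Set.Ioi a, F u ∂(discount γ) := by
  rw [← smul_map_add_discount, lintegral_smul_measure, lintegral_map hF (by fun_prop), smul_eq_mul]

lemma integral_discount_shift (γ : ℝ) (a : ℝ≥0) {F : ℝ≥0 → ℝ} (hF : Measurable F) :
    Real.exp (-γ * a) * ∫ t, F (a + t) ∂(discount γ) = ∫ u in Set.Ici a, F u ∂(discount γ) := by
  rw [← Measure.restrict_congr_set Ioi_ae_eq_Ici, ← smul_map_add_discount, integral_smul_measure,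
    integral_map (by fun_prop) hF.aestronglyMeasurable, ENNReal.toReal_ofReal (Real.exp_nonneg _),
    smul_eq_mul]

lemma integral_discount_Iio_exp (γ α : ℝ) (t : ℝ≥0) :
    (γ - α) * ∫ u in Set.Iio t, Real.exp (α * u) ∂(discount γ) =
      1 - Real.exp (-(γ - α) * t) := by
  rw [← integral_indicator measurableSet_Iio,
    integral_discount γ ((by fun_prop : Measurable fun u : ℝ≥0 => Real.exp (α * u)).indicator
      measurableSet_Iio)]
  have h1 : ∫ u in Set.Ioi (0 : ℝ), Real.exp (-γ * u) *
      (Set.Iio t).indicator (fun u : ℝ≥0 => Real.exp (α * u)) u.toNNReal =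
      ∫ u in (0 : ℝ)..t, Real.exp (-(γ - α) * u) := by
    rw [intervalIntegral.integral_of_le t.coe_nonneg, ← integral_Ioc_eq_integral_Ioo.symm,
      ← integral_indicator measurableSet_Ioi, ← integral_indicator measurableSet_Ioo]
    refine integral_congr_ae (Eventually.of_forall fun u => ?_)
    by_cases hu : 0 < u
    · by_cases hut : u < t
      · have h2 : u.toNNReal ∈ Set.Iio t := by
          rw [Set.mem_Iio, Real.toNNReal_lt_iff_lt_coe hu.le]; exact hut
        simp only [Set.indicator_of_mem (Set.mem_Ioi.2 hu), Set.indicator_of_mem h2,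
          Set.indicator_of_mem (Set.mem_Ioo.2 ⟨hu, hut⟩), Real.coe_toNNReal _ hu.le,
          ← Real.exp_add]
        ring_nf
      · have h2 : u.toNNReal ∉ Set.Iio t := by
          rw [Set.mem_Iio, Real.toNNReal_lt_iff_lt_coe hu.le]; exact hut
        have h3 : u ∉ Set.Ioo 0 (t : ℝ) := fun h => hut h.2
        simp only [Set.indicator_of_mem (Set.mem_Ioi.2 hu), Set.indicator_of_notMem h2,
          Set.indicator_of_notMem h3, mul_zero]
    · have h3 : u ∉ Set.Ioo 0 (t : ℝ) := fun h => hu h.1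
      simp only [Set.indicator_of_notMem (by simpa using hu : u ∉ Set.Ioi (0 : ℝ)),
        Set.indicator_of_notMem h3]
  rw [h1, ← intervalIntegral.integral_const_mul,
    intervalIntegral.integral_eq_sub_of_hasDerivAt (f := fun u => -Real.exp (-(γ - α) * u))]
  · simp; ring
  · intro u _
    have := ((hasDerivAt_id u).const_mul (-(γ - α))).exp.neg
    simp only [id] at this
    convert! this using 1
    ring
  · exact (by fun_prop : Continuous fun u : ℝ =>
      (γ - α) * Real.exp (-(γ - α) * u)).intervalIntegrable _ _

/-- Resolvent identity for the discount measures. -/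
lemma discount_eq_add_conv {a b : ℝ} (ha : 0 < a) (hab : a < b) :
    discount a = discount b + ENNReal.ofReal (b - a) •
      ((discount b).prod (discount a)).map (fun q => q.1 + q.2) := by
  have := isFiniteMeasure_discount ha
  have := isFiniteMeasure_discount (ha.trans hab)
  have hm : Measurable fun q : ℝ≥0 × ℝ≥0 => q.1 + q.2 := by fun_prop
  ext S hS
  set F : ℝ≥0 → ℝ≥0∞ := S.indicator 1 with hFdef
  have hF : Measurable F := measurable_one.indicator hS
  -- Translate the inner integral to `t > u`, at the cost of a factor `e^{au}`, and exchange the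
  -- integrals. Integrating `e^{au}` over `u < t` against `discount b` leaves the weight `1 -
  -- e^{-(b-a)t}`, which complements the density `e^{-(b-a)t}` of `discount b` relative to `discount
  -- a`.
  have key : ENNReal.ofReal (b - a) * ∫⁻ u, ∫⁻ t, F (u + t) ∂(discount a) ∂(discount b) =
      ∫⁻ t, ENNReal.ofReal (1 - Real.exp (-(b - a) * t)) * F t ∂(discount a) := by
    have h1 : ∀ u : ℝ≥0, ∫⁻ t, F (u + t) ∂(discount a) =
        ∫⁻ t, ENNReal.ofReal (Real.exp (a * u)) * (Set.Ioi u).indicator F t ∂(discount a) := by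
      intro u
      rw [lintegral_const_mul _ (hF.indicator measurableSet_Ioi),
        lintegral_indicator measurableSet_Ioi, ← lintegral_discount_shift a u hF, ← mul_assoc,
        ← ENNReal.ofReal_mul (Real.exp_nonneg _), ← Real.exp_add]
      simp
    simp_rw [h1]
    have hmeas : Measurable fun q : ℝ≥0 × ℝ≥0 =>
        ENNReal.ofReal (Real.exp (a * q.1)) * (Set.Ioi q.1).indicator F q.2 := by
      refine Measurable.mul (by fun_prop) ?_
      have : (fun q : ℝ≥0 × ℝ≥0 => (Set.Ioi q.1).indicator F q.2) =
          {q : ℝ≥0 × ℝ≥0 | q.1 < q.2}.indicator fun q => F q.2 := by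
        ext q
        simp [Set.indicator]
      rw [this]
      exact (hF.comp measurable_snd).indicator (measurableSet_lt measurable_fst measurable_snd)
    rw [lintegral_lintegral_swap hmeas.aemeasurable,
      ← lintegral_const_mul _ hmeas.lintegral_prod_left']
    refine lintegral_congr fun t => ?_
    have h2 : ∀ u : ℝ≥0, ENNReal.ofReal (Real.exp (a * u)) * (Set.Ioi u).indicator F t =
        (Set.Iio t).indicator (fun u : ℝ≥0 => ENNReal.ofReal (Real.exp (a * u))) u * F t := by
      intro u
      by_cases hut : u < t <;> simp [Set.indicator, hut]
    simp_rw [h2]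
    rw [lintegral_mul_const _ ((by fun_prop : Measurable fun u : ℝ≥0 =>
      ENNReal.ofReal (Real.exp (a * u))).indicator measurableSet_Iio),
      lintegral_indicator measurableSet_Iio, ← mul_assoc]
    congr 1
    rw [← integral_discount_Iio_exp, ENNReal.ofReal_mul (by linarith)]
    congr 1
    rw [ofReal_integral_eq_lintegral_ofReal]
    · refine Integrable.of_bound (C := Real.exp (a * t)) (by fun_prop) ?_
      filter_upwards [ae_restrict_mem measurableSet_Iio] with u hu
      rw [Real.norm_of_nonneg (Real.exp_nonneg _), Real.exp_le_exp]
      have : (u : ℝ) ≤ t := by exact_mod_cast (le_of_lt hu)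
      gcongr
    · exact Eventually.of_forall fun u => Real.exp_nonneg _
  have hb : ∫⁻ t, F t ∂(discount b) =
      ∫⁻ t, ENNReal.ofReal (Real.exp (-(b - a) * t)) * F t ∂(discount a) := by
    rw [lintegral_discount b hF, lintegral_discount a (by fun_prop)]
    refine setLIntegral_congr_fun measurableSet_Ioi fun u hu => ?_
    rw [Real.coe_toNNReal _ (le_of_lt hu), ← mul_assoc, ← ENNReal.ofReal_mul (Real.exp_nonneg _),
      ← Real.exp_add]
    ring_nf
  rw [Measure.add_apply, Measure.smul_apply, ← lintegral_indicator_one hS,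
    ← lintegral_indicator_one hS, ← lintegral_indicator_one hS, lintegral_map hF hm,
    lintegral_prod _ (by fun_prop), smul_eq_mul, key, hb,
    ← lintegral_add_left (by fun_prop)]
  refine lintegral_congr fun t => ?_
  rw [← add_mul, ← ENNReal.ofReal_add (Real.exp_nonneg _)]
  · simp [hFdef]
  · simp only [sub_nonneg, Real.exp_le_one_iff]
    have := t.2
    nlinarith

lemma integrable_of_bounded {α : Type*} [MeasurableSpace α] {μ : Measure α} [IsFiniteMeasure μ]
    {F : α → ℝ} (hF : BoundedMeasurable F) : Integrable F μ := by
  obtain ⟨hm, C, hC⟩ := hF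
  exact Integrable.of_bound hm.aestronglyMeasurable C (Eventually.of_forall hC)

lemma BoundedMeasurable.comp {α β : Type*} [MeasurableSpace α] [MeasurableSpace β] {F : β → ℝ}
    (hF : BoundedMeasurable F) {f : α → β} (hf : Measurable f) :
    BoundedMeasurable fun a => F (f a) :=
  ⟨hF.1.comp hf, hF.2.imp fun _ h a => h (f a)⟩

lemma integral_discount_conv_aux {a b : ℝ} (ha : 0 < a) (hab : a < b) {F : ℝ≥0 → ℝ}
    (hF : BoundedMeasurable F) :
    (b - a) * ∫ u, ∫ t, F (u + t) ∂(discount a) ∂(discount b) =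
      ∫ u, F u ∂(discount a) - ∫ u, F u ∂(discount b) := by
  have := isFiniteMeasure_discount ha
  have := isFiniteMeasure_discount (ha.trans hab)
  have hm : Measurable fun q : ℝ≥0 × ℝ≥0 => q.1 + q.2 := by fun_prop
  have hfin : IsFiniteMeasure (ENNReal.ofReal (b - a) •
      ((discount b).prod (discount a)).map (fun q => q.1 + q.2)) :=
    Measure.smul_finite _ ENNReal.ofReal_ne_top
  conv_rhs => rw [discount_eq_add_conv ha hab]
  rw [integral_add_measure (integrable_of_bounded hF) (integrable_of_bounded hF),
    integral_smul_measure, integral_map hm.aemeasurable hF.1.aestronglyMeasurable,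
    integral_prod _ (integrable_of_bounded (hF.comp hm)),
    ENNReal.toReal_ofReal (by linarith), smul_eq_mul]
  ring

/-- Resolvent identity for the discount measures. -/
lemma integral_discount_conv {a b : ℝ} (ha : 0 < a) (hb : 0 < b) {F : ℝ≥0 → ℝ}
    (hF : BoundedMeasurable F) :
    (b - a) * ∫ u, ∫ t, F (u + t) ∂(discount a) ∂(discount b) =
      ∫ u, F u ∂(discount a) - ∫ u, F u ∂(discount b) := by
  have := isFiniteMeasure_discount ha
  have := isFiniteMeasure_discount hb
  rcases lt_trichotomy a b with h | h | h
  · exact integral_discount_conv_aux ha h hF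
  · simp [h]
  -- The convolution is symmetric in the two rates, and both sides of the identity change sign when
  -- `a` and `b` are exchanged.
  · have h1 := integral_discount_conv_aux hb h hF
    rw [integral_integral_swap (integrable_of_bounded (hF.comp (by fun_prop)))] at h1
    simp_rw [add_comm] at h1 ⊢
    linarith

/-! ### Stability of bounded measurable functions -/

namespace BoundedMeasurable

variable {α β : Type*} [MeasurableSpace α] [MeasurableSpace β]

lemma add {F G : α → ℝ} (hF : BoundedMeasurable F) (hG : BoundedMeasurable G) :
    BoundedMeasurable fun a => F a + G a := by
  obtain ⟨hF, C, hC⟩ := hF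
  obtain ⟨hG, D, hD⟩ := hG
  exact ⟨hF.add hG, C + D, fun a => (abs_add_le _ _).trans (add_le_add (hC a) (hD a))⟩

lemma const_mul {F : α → ℝ} (hF : BoundedMeasurable F) (c : ℝ) :
    BoundedMeasurable fun a => c * F a := by
  obtain ⟨hF, C, hC⟩ := hF
  refine ⟨hF.const_mul c, |c| * C, fun a => ?_⟩
  rw [abs_mul]
  exact mul_le_mul_of_nonneg_left (hC a) (abs_nonneg c)

lemma sub {F G : α → ℝ} (hF : BoundedMeasurable F) (hG : BoundedMeasurable G) :
    BoundedMeasurable fun a => F a - G a := by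
  simpa [sub_eq_add_neg] using hF.add (hG.const_mul (-1))

lemma max {F G : α → ℝ} (hF : BoundedMeasurable F) (hG : BoundedMeasurable G) :
    BoundedMeasurable fun a => Max.max (F a) (G a) := by
  obtain ⟨hF, C, hC⟩ := hF
  obtain ⟨hG, D, hD⟩ := hG
  exact ⟨hF.max hG, Max.max C D, fun a => abs_max_le_max_abs_abs.trans
    (max_le_max (hC a) (hD a))⟩

lemma const (c : ℝ) : BoundedMeasurable fun _ : α => c :=
  ⟨measurable_const, |c|, fun _ => le_rfl⟩

lemma indicator {F : α → ℝ} (hF : BoundedMeasurable F) {S : Set α} (hS : MeasurableSet S) :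
    BoundedMeasurable (S.indicator F) := by
  obtain ⟨hF, C, hC⟩ := hF
  refine ⟨hF.indicator hS, C, fun a => ?_⟩
  by_cases ha : a ∈ S
  · simpa [ha] using hC a
  · simpa [ha] using (abs_nonneg _).trans (hC a)

lemma integral_kernel {F : α × β → ℝ} (hF : BoundedMeasurable F) (κ : Kernel α β)
    [IsMarkovKernel κ] : BoundedMeasurable fun a => ∫ b, F (a, b) ∂κ a := by
  obtain ⟨hF, C, hC⟩ := hF
  refine ⟨hF.stronglyMeasurable.integral_kernel_prod_right'.measurable, C, fun a => ?_⟩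
  have := norm_integral_le_of_norm_le_const (μ := κ a) (f := fun b => F (a, b)) (C := C)
    (Eventually.of_forall fun b => hC _)
  simpa using this

lemma integral_measure {F : α × β → ℝ} (hF : BoundedMeasurable F) (μ : Measure β)
    [IsFiniteMeasure μ] : BoundedMeasurable fun a => ∫ b, F (a, b) ∂μ := by
  obtain ⟨hF, C, hC⟩ := hF
  exact ⟨hF.stronglyMeasurable.integral_prod_right'.measurable, C * μ.real Set.univ,
    fun a => norm_integral_le_of_norm_le_const (μ := μ) (f := fun b => F (a, b)) (C := C)
    (Eventually.of_forall fun b => hC _)⟩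

end BoundedMeasurable

lemma BoundedContinuousFunction.boundedMeasurable {α : Type*} [TopologicalSpace α]
    [MeasurableSpace α] [OpensMeasurableSpace α] (F : α →ᵇ ℝ) : BoundedMeasurable F :=
  ⟨F.continuous.measurable, ‖F‖, F.norm_coe_le_norm⟩

/-! ### Payoffs along a single path -/

namespace RCPath

variable {E : Type*} [MetricSpace E]

/-- The running payoff along a path. -/
noncomputable def running (O : Set E) (γ : ℝ) (g : ℝ≥0 × E → ℝ) (s : ℝ≥0) (p : RCPath E) : ℝ :=
  ∫ u, {u : ℝ≥0 | (u : ℝ≥0∞) < exit O p}.indicator (fun u => g (s + u, p.1 u)) u ∂(discount γ)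

/-- The exit payoff along a path. -/
noncomputable def exitPay (O : Set E) (γ : ℝ) (h : ℝ≥0 × E → ℝ) (s : ℝ≥0) (p : RCPath E) : ℝ :=
  {p | exit O p ≠ ⊤}.indicator (fun p => Real.exp (-γ * (exit O p).toNNReal) *
    h (s + (exit O p).toNNReal, p.1 (exit O p).toNNReal)) p

/-- The total payoff along a path. -/
noncomputable def payoff (O : Set E) (γ : ℝ) (g h : ℝ≥0 × E → ℝ) (s : ℝ≥0) (p : RCPath E) : ℝ :=
  running O γ g s p + exitPay O γ h s p

lemma measurableSet_lt_exit_left (O : Set E) (p : RCPath E) :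
    MeasurableSet {u : ℝ≥0 | (u : ℝ≥0∞) < exit O p} :=
  measurableSet_lt measurable_coe_nnreal_ennreal measurable_const

variable [MeasurableSpace E] [BorelSpace E]

lemma measurableSet_lt_exit (O : Set E) :
    MeasurableSet {q : ℝ≥0 × RCPath E | (q.1 : ℝ≥0∞) < exit O q.2} :=
  measurableSet_lt (measurable_coe_nnreal_ennreal.comp measurable_fst)
    ((measurable_exit O).comp measurable_snd)

lemma measurableSet_lt_exit_right (O : Set E) (u : ℝ≥0) :
    MeasurableSet {p : RCPath E | (u : ℝ≥0∞) < exit O p} :=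
  measurableSet_lt measurable_const (measurable_exit O)

lemma measurableSet_exit_ne_top (O : Set E) : MeasurableSet {p : RCPath E | exit O p ≠ ⊤} :=
  (measurable_exit O (measurableSet_singleton ⊤)).compl

lemma measurable_shift_prod : Measurable fun q : ℝ≥0 × RCPath E => shift q.1 q.2 :=
  Measurable.subtype_mk (measurable_pi_lambda _ fun t =>
    measurable_eval_prod.comp ((measurable_fst.add_const t).prodMk measurable_snd))

lemma measurable_eval_exit (O : Set E) :
    Measurable fun p : RCPath E => p.1 (exit O p).toNNReal :=
  measurable_eval_prod.comp ((measurable_exit O).ennreal_toNNReal.prodMk measurable_id)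

/-- The integrand of the running payoff. -/
lemma boundedMeasurable_running_integrand (O : Set E) {g : ℝ≥0 × E → ℝ}
    (hg : BoundedMeasurable g) :
    BoundedMeasurable fun q : (ℝ≥0 × RCPath E) × ℝ≥0 =>
      {u : ℝ≥0 | (u : ℝ≥0∞) < exit O q.1.2}.indicator
        (fun u => g (q.1.1 + u, q.1.2.1 u)) q.2 := by
  have h1 : Measurable fun q : (ℝ≥0 × RCPath E) × ℝ≥0 => (q.1.1 + q.2, q.1.2.1 q.2) :=
    (measurable_fst.fst.add measurable_snd).prodMk
      (measurable_eval_prod.comp (measurable_snd.prodMk measurable_fst.snd))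
  exact (hg.comp h1).indicator
    ((measurable_snd.prodMk measurable_fst.snd) (measurableSet_lt_exit O))

lemma boundedMeasurable_running (O : Set E) {γ : ℝ} (hγ : 0 < γ) {g : ℝ≥0 × E → ℝ}
    (hg : BoundedMeasurable g) :
    BoundedMeasurable fun q : ℝ≥0 × RCPath E => running O γ g q.1 q.2 := by
  have := isFiniteMeasure_discount hγ
  exact (boundedMeasurable_running_integrand O hg).integral_measure _

lemma boundedMeasurable_exitPay (O : Set E) {γ : ℝ} (hγ : 0 ≤ γ) {h : ℝ≥0 × E → ℝ}
    (hh : BoundedMeasurable h) :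
    BoundedMeasurable fun q : ℝ≥0 × RCPath E => exitPay O γ h q.1 q.2 := by
  have h1 : Measurable fun q : ℝ≥0 × RCPath E => (exit O q.2).toNNReal :=
    ((measurable_exit O).comp measurable_snd).ennreal_toNNReal
  have h2 : Measurable fun q : ℝ≥0 × RCPath E =>
      (q.1 + (exit O q.2).toNNReal, q.2.1 (exit O q.2).toNNReal) :=
    (measurable_fst.add h1).prodMk ((measurable_eval_exit O).comp measurable_snd)
  obtain ⟨hm, C, hC⟩ := hh.comp h2
  have h3 : BoundedMeasurable fun q : ℝ≥0 × RCPath E =>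
      Real.exp (-γ * (exit O q.2).toNNReal) *
        h (q.1 + (exit O q.2).toNNReal, q.2.1 (exit O q.2).toNNReal) := by
    refine ⟨(by fun_prop : Measurable fun t : ℝ≥0 => Real.exp (-γ * t)).comp h1 |>.mul hm, C,
      fun q => ?_⟩
    rw [abs_mul, abs_of_nonneg (Real.exp_nonneg _)]
    have h4 : Real.exp (-γ * (exit O q.2).toNNReal) ≤ 1 := by
      rw [Real.exp_le_one_iff]
      have := (exit O q.2).toNNReal.coe_nonneg
      nlinarith
    exact (mul_le_of_le_one_left (abs_nonneg _) h4).trans (hC q)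
  exact h3.indicator (measurable_snd (measurableSet_exit_ne_top O))

lemma boundedMeasurable_payoff (O : Set E) {γ : ℝ} (hγ : 0 < γ) {g h : ℝ≥0 × E → ℝ}
    (hg : BoundedMeasurable g) (hh : BoundedMeasurable h) :
    BoundedMeasurable fun q : ℝ≥0 × RCPath E => payoff O γ g h q.1 q.2 :=
  (boundedMeasurable_running O hγ hg).add (boundedMeasurable_exitPay O hγ.le hh)

-- Before the exit, the shifted path leaves `O` exactly `u` earlier. Its running reward is therefore
-- the original one read from time `u` on, and its exit reward is the original one with the discount
-- over `[0, u]` undone, whence the factor `e^{αu}`.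
omit [MeasurableSpace E] [BorelSpace E] in
lemma indicator_payoff_shift (O : Set E) (α : ℝ) (g h : ℝ≥0 × E → ℝ) (s u : ℝ≥0)
    (p : RCPath E) :
    {u : ℝ≥0 | (u : ℝ≥0∞) < exit O p}.indicator
        (fun u => payoff O α g h (s + u) (shift u p)) u =
      ∫ r, {t : ℝ≥0 | (t : ℝ≥0∞) < exit O p}.indicator (fun t => g (s + t, p.1 t)) (u + r)
        ∂(discount α) +
      {u : ℝ≥0 | (u : ℝ≥0∞) < exit O p}.indicator (fun u : ℝ≥0 => Real.exp (α * u)) u *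
        exitPay O α h s p := by
  by_cases hu : (u : ℝ≥0∞) < exit O p
  · have hex := exit_eq_add_exit_shift hu
    rw [Set.indicator_of_mem (show u ∈ {u : ℝ≥0 | (u : ℝ≥0∞) < exit O p} from hu),
      Set.indicator_of_mem (show u ∈ {u : ℝ≥0 | (u : ℝ≥0∞) < exit O p} from hu), payoff]
    congr 1
    · rw [running]
      refine integral_congr_ae (Eventually.of_forall fun r => ?_)
      have hiff : ((u + r : ℝ≥0) : ℝ≥0∞) < exit O p ↔ (r : ℝ≥0∞) < exit O (shift u p) := by
        rw [hex, ENNReal.coe_add]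
        exact ENNReal.add_lt_add_iff_left ENNReal.coe_ne_top
      simp only [Set.indicator, Set.mem_ofPred_eq, hiff, shift_apply, add_assoc]
    · by_cases ht : exit O (shift u p) = ⊤
      · simp [exitPay, hex, ht]
      · have ht' : exit O p ≠ ⊤ := by simp [hex, ht]
        have h1 : (exit O p).toNNReal = u + (exit O (shift u p)).toNNReal := by
          rw [hex, ENNReal.toNNReal_add ENNReal.coe_ne_top ht, ENNReal.toNNReal_coe]
        rw [exitPay, exitPay,
          Set.indicator_of_mem (show shift u p ∈ {p | exit O p ≠ ⊤} from ht),
          Set.indicator_of_mem (show p ∈ {p | exit O p ≠ ⊤} from ht'), h1, shift_apply,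
          ← add_assoc s, ← mul_assoc, ← Real.exp_add, NNReal.coe_add]
        ring_nf
  · rw [Set.indicator_of_notMem (show u ∉ {u : ℝ≥0 | (u : ℝ≥0∞) < exit O p} from hu),
      Set.indicator_of_notMem (show u ∉ {u : ℝ≥0 | (u : ℝ≥0∞) < exit O p} from hu)]
    have h1 : ∀ r, {t : ℝ≥0 | (t : ℝ≥0∞) < exit O p}.indicator
        (fun t => g (s + t, p.1 t)) (u + r) = 0 := by
      intro r
      apply Set.indicator_of_notMem
      intro h
      refine hu (lt_of_le_of_lt ?_ h)
      simp
    simp [h1]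

/-- The pathwise form of the resolvent identity. -/
lemma integral_payoff_shift (O : Set E) {α γ : ℝ} (hα : 0 < α) (hγ : 0 < γ) {g h : ℝ≥0 × E → ℝ}
    (hg : BoundedMeasurable g) (s : ℝ≥0) (p : RCPath E) :
    (γ - α) * ∫ u, {u : ℝ≥0 | (u : ℝ≥0∞) < exit O p}.indicator
        (fun u => payoff O α g h (s + u) (shift u p)) u ∂(discount γ) =
      payoff O α g h s p - payoff O γ g h s p := by
  have := isFiniteMeasure_discount hα
  have := isFiniteMeasure_discount hγ
  have hF : BoundedMeasurable
      ({t : ℝ≥0 | (t : ℝ≥0∞) < exit O p}.indicator (fun t => g (s + t, p.1 t))) :=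
    (boundedMeasurable_running_integrand O hg).comp (f := fun t => ((s, p), t)) (by fun_prop)
  simp_rw [indicator_payoff_shift]
  -- The integral of `(γ - α) e^{(α-γ)u}` over `u < τ` is `1 - e^{-(γ-α)τ}`, and the second term
  -- turns the discount `e^{-ατ}` of the exit reward into `e^{-γτ}`.
  have hexp : (γ - α) * ∫ u, {u : ℝ≥0 | (u : ℝ≥0∞) < exit O p}.indicator
      (fun u : ℝ≥0 => Real.exp (α * u)) u * exitPay O α h s p ∂(discount γ) =
      exitPay O α h s p - exitPay O γ h s p := by
    by_cases ht : exit O p = ⊤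
    · simp [exitPay, ht]
    · lift exit O p to ℝ≥0 using ht with t htt
      have hset : {u : ℝ≥0 | (u : ℝ≥0∞) < t} = Set.Iio t := by ext; simp
      rw [integral_mul_const, ← mul_assoc, hset, integral_indicator measurableSet_Iio,
        integral_discount_Iio_exp, sub_mul, one_mul, exitPay, exitPay,
        Set.indicator_of_mem (by simp [← htt]), Set.indicator_of_mem (by simp [← htt]), ← htt,
        ENNReal.toNNReal_coe, ← mul_assoc, ← Real.exp_add]
      ring_nf
  -- On an infinite horizon `e^{αu}` need not be integrable against `discount γ`. There it
  -- multiplies a zero exit payoff, so this case is split off before the integral of the sum is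
  -- separated.
  by_cases ht : exit O p = ⊤
  · have h0 : ∀ c, exitPay O c h s p = 0 := fun c => by simp [exitPay, ht]
    simp only [h0, mul_zero, add_zero, payoff]
    exact integral_discount_conv hα hγ hF
  · rw [integral_add, mul_add, hexp, integral_discount_conv hα hγ hF, payoff, payoff, running,
      running]
    · ring
    · exact integrable_of_bounded ((hF.comp (f := fun q : ℝ≥0 × ℝ≥0 => q.1 + q.2)
        (by fun_prop)).integral_measure _)
    · refine Integrable.mul_const ?_ _
      refine integrable_of_bounded ⟨(by fun_prop : Measurable fun u : ℝ≥0 =>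
        Real.exp (α * u)).indicator (measurableSet_lt_exit_left O p),
        Real.exp (α * (exit O p).toNNReal), fun u => ?_⟩
      by_cases hu : (u : ℝ≥0∞) < exit O p
      · rw [Set.indicator_of_mem (show u ∈ {u : ℝ≥0 | (u : ℝ≥0∞) < exit O p} from hu),
          abs_of_nonneg (Real.exp_nonneg _), Real.exp_le_exp]
        have : u ≤ (exit O p).toNNReal := by
          rw [← ENNReal.coe_le_coe, ENNReal.coe_toNNReal ht]; exact hu.le
        gcongr
      · rw [Set.indicator_of_notMem (show u ∉ {u : ℝ≥0 | (u : ℝ≥0∞) < exit O p} from hu)]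
        simpa using Real.exp_nonneg _

end RCPath

/-! ### Expected payoffs and the resolvent identity -/

lemma integral_bind_kernel {α β : Type*} [MeasurableSpace α] [MeasurableSpace β] {μ : Measure α}
    {κ : Kernel α β} {f : β → ℝ} (hf : Integrable f (μ.bind κ)) :
    ∫ z, f z ∂(μ.bind κ) = ∫ x, ∫ y, f y ∂(κ x) ∂μ := by
  have h := Kernel.integral_comp (κ := Kernel.const Unit μ) (η := κ) (a := ()) (f := f)
  rw [Kernel.comp_apply, Kernel.const_apply] at h
  exact h hf

namespace StandardMarkovProcess

variable {E : Type*} [MetricSpace E] [MeasurableSpace E] [BorelSpace E]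
  {Ω : Type*} [MeasurableSpace Ω] (M : StandardMarkovProcess E Ω)

/-- The expected payoff computed with the laws on path space. -/
noncomputable def value (O : Set E) (γ : ℝ) (g h : ℝ≥0 × E → ℝ) : ℝ≥0 × E → ℝ :=
  fun q => ∫ p, RCPath.payoff O γ g h q.1 p ∂(M.pathLaw q.2)

lemma boundedMeasurable_value (O : Set E) {γ : ℝ} (hγ : 0 < γ) {g h : ℝ≥0 × E → ℝ}
    (hg : BoundedMeasurable g) (hh : BoundedMeasurable h) :
    BoundedMeasurable (M.value O γ g h) :=
  ((RCPath.boundedMeasurable_payoff O hγ hg hh).comp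
    (f := fun r : (ℝ≥0 × E) × RCPath E => (r.1.1, r.2)) (by fun_prop)).integral_kernel
      (Kernel.prodMkLeft ℝ≥0 M.pathLaw)

lemma integrable_payoff (O : Set E) {γ : ℝ} (hγ : 0 < γ) {g h : ℝ≥0 × E → ℝ}
    (hg : BoundedMeasurable g) (hh : BoundedMeasurable h) (s : ℝ≥0) (x : E) :
    Integrable (RCPath.payoff O γ g h s) (M.pathLaw x) :=
  integrable_of_bounded ((RCPath.boundedMeasurable_payoff O hγ hg hh).comp
    (f := fun p => (s, p)) (by fun_prop))

lemma runningPayoff_eq {O : Set E} {γ : ℝ} {g : ℝ≥0 × E → ℝ} (hg : Measurable g) {ω : Ω}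
    (hω : M.exitTime O ω = M.exitLimit O ω) (s : ℝ≥0) :
    M.runningPayoff O γ g s ω = RCPath.running O γ g s (M.path ω) := by
  set S : Set ℝ≥0 := {u : ℝ≥0 | (u : ℝ≥0∞) < RCPath.exit O (M.path ω)} with hS
  have hSm : MeasurableSet S := RCPath.measurableSet_lt_exit_left O (M.path ω)
  have hX : Measurable fun u => M.X u ω :=
    RCPath.measurable_eval_prod.comp (measurable_id.prodMk (measurable_const (a := M.path ω)))
  have hset : {u : ℝ | 0 ≤ u ∧ (u.toNNReal : WithTop ℝ≥0) < M.exitTime O ω} =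
      Set.Ici 0 ∩ Real.toNNReal ⁻¹' S := by
    ext u
    rw [hω]
    rfl
  rw [runningPayoff, RCPath.running, integral_discount, hset,
    ← setIntegral_congr_set (Ioi_ae_eq_Ici.inter (EventuallyEq.refl _ (Real.toNNReal ⁻¹' S))),
    ← setIntegral_indicator (measurable_real_toNNReal hSm)]
  · refine integral_congr_ae (Eventually.of_forall fun u => ?_)
    change _ = Real.exp (-γ * u) * S.indicator (fun u => g (s + u, (M.path ω).1 u)) u.toNNReal
    by_cases hu : u.toNNReal ∈ S
    · rw [Set.indicator_of_mem hu, Set.indicator_of_mem (show u ∈ Real.toNNReal ⁻¹' S from hu)]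
      rfl
    · rw [Set.indicator_of_notMem hu, mul_zero,
        Set.indicator_of_notMem (show u ∉ Real.toNNReal ⁻¹' S from hu)]
  · exact (hg.comp ((measurable_const.add measurable_id).prodMk hX)).indicator hSm

omit [BorelSpace E] in
lemma exitPayoff_eq {O : Set E} {γ : ℝ} {h : ℝ≥0 × E → ℝ} {ω : Ω}
    (hω : M.exitTime O ω = M.exitLimit O ω) (s : ℝ≥0) :
    M.exitPayoff O γ h s ω = RCPath.exitPay O γ h s (M.path ω) := by
  rw [exitPayoff, RCPath.exitPay]
  split_ifs with ht
  · rw [hω, M.exitLimit_eq_top_iff] at ht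
    simp [ht]
  · rw [hω] at ht
    obtain ⟨t, hte⟩ := WithTop.ne_top_iff_exists.1 ht
    have h1 : RCPath.exit O (M.path ω) = t := M.exitLimit_eq_coe_iff.1 hte.symm
    have h2 : M.exitTime O ω = t := hω.trans hte.symm
    rw [M.stoppedValue_of_eq_coe h2, h2, Set.indicator_of_mem (by simp [h1]), h1]
    rfl

/-- The payoffs of the process agree almost surely with functionals of its path, because the two
exit times do. From here on, expectations depend only on the law of the path. -/
lemma expectedPayoff_eq_value {O : Set E} (hO : IsOpen O) {γ : ℝ} (hγ : 0 < γ)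
    {g h : ℝ≥0 × E → ℝ} (hg : BoundedMeasurable g) (hh : BoundedMeasurable h) :
    M.expectedPayoff O γ g h = M.value O γ g h := by
  ext q
  rw [expectedPayoff, value, pathLaw_apply, integral_map M.measurable_path.aemeasurable
    (M.integrable_payoff O hγ hg hh q.1 q.2).aestronglyMeasurable]
  refine integral_congr_ae ?_
  filter_upwards [M.exitTime_ae_eq hO q.2] with ω hω
  rw [M.runningPayoff_eq hg.1 hω, M.exitPayoff_eq hω, RCPath.payoff]

/-- The Markov property at a fixed time before the exit. -/
lemma integral_shift (O : Set E) (u : ℝ≥0) (x : E) {Ψ : RCPath E → ℝ}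
    (hΨ : BoundedMeasurable Ψ) :
    ∫ p in {p | (u : ℝ≥0∞) < RCPath.exit O p}, Ψ (p.shift u) ∂(M.pathLaw x) =
      ∫ p in {p | (u : ℝ≥0∞) < RCPath.exit O p}, ∫ p', Ψ p' ∂(M.pathLaw (p.1 u))
        ∂(M.pathLaw x) := by
  have hA := RCPath.measurableSet_lt_exit_right O u
  -- The event that exit has not occurred by time `u` is the complement of a stopping time event,
  -- hence known at `u`.
  have hA' : MeasurableSet[M.F u] (M.path ⁻¹' {p | (u : ℝ≥0∞) < RCPath.exit O p}) := by
    have := (M.isStoppingTime_exitLimit O u).compl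
    convert this using 1
    ext ω
    simp only [Set.mem_compl_iff, Set.mem_ofPred_eq, M.exitLimit_le_coe_iff, not_le]
    rfl
  have hm : Measurable fun ω => (M.path ω).shift u :=
    (RCPath.measurable_shift u).comp M.measurable_path
  have hΨ2 : BoundedMeasurable fun z => ∫ p', Ψ p' ∂(M.pathLaw z) :=
    (hΨ.comp (f := fun r : E × RCPath E => r.2) measurable_snd).integral_kernel M.pathLaw
  rw [pathLaw_apply, setIntegral_map hA
      (hΨ.comp (RCPath.measurable_shift u)).1.aestronglyMeasurable M.measurable_path.aemeasurable,
    setIntegral_map hA (hΨ2.comp (RCPath.measurable_eval u)).1.aestronglyMeasurable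
      M.measurable_path.aemeasurable,
    ← integral_map hm.aemeasurable hΨ.1.aestronglyMeasurable, M.map_shift_path u x hA',
    integral_bind_kernel (integrable_of_bounded hΨ),
    integral_map (M.measurable_X u).aemeasurable hΨ2.1.aestronglyMeasurable]
  rfl

lemma value_running (O : Set E) {γ : ℝ} (hγ : 0 < γ) {g : ℝ≥0 × E → ℝ}
    (hg : BoundedMeasurable g) (s : ℝ≥0) (x : E) :
    ∫ p, RCPath.running O γ g s p ∂(M.pathLaw x) =
      ∫ u, ∫ p in {p | (u : ℝ≥0∞) < RCPath.exit O p}, g (s + u, p.1 u) ∂(M.pathLaw x)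
        ∂(discount γ) := by
  have := isFiniteMeasure_discount hγ
  simp only [RCPath.running]
  rw [integral_integral_swap]
  · refine integral_congr_ae (Eventually.of_forall fun u => ?_)
    simp only
    rw [← integral_indicator (RCPath.measurableSet_lt_exit_right O u)]
    rfl
  · exact integrable_of_bounded ((RCPath.boundedMeasurable_running_integrand O hg).comp
      (f := fun r : RCPath E × ℝ≥0 => ((s, r.1), r.2)) (by fun_prop))

/-- Resolvent identity: changing the discount rate of an expected payoff. -/
lemma value_eq_value_add (O : Set E) {α γ : ℝ} (hα : 0 < α) (hγ : 0 < γ) {g h : ℝ≥0 × E → ℝ}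
    (hg : BoundedMeasurable g) (hh : BoundedMeasurable h) :
    M.value O α g h = M.value O γ (fun q => g q + (γ - α) * M.value O α g h q) h := by
  have := isFiniteMeasure_discount hγ
  ext ⟨s, x⟩
  have hv := M.boundedMeasurable_value O hα hg hh
  have hbr : ∀ {k : ℝ≥0 × E → ℝ}, BoundedMeasurable k → ∀ p : RCPath E,
      Integrable ({u : ℝ≥0 | (u : ℝ≥0∞) < RCPath.exit O p}.indicator
        (fun u => k (s + u, p.1 u))) (discount γ) := fun hk p =>
    integrable_of_bounded ((RCPath.boundedMeasurable_running_integrand O hk).comp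
      (f := fun t => ((s, p), t)) (by fun_prop))
  have hsplit : ∀ p, RCPath.payoff O γ (fun q => g q + (γ - α) * M.value O α g h q) h s p =
      RCPath.payoff O γ g h s p + (γ - α) * RCPath.running O γ (M.value O α g h) s p := by
    intro p
    have h1 : RCPath.running O γ (fun q => g q + (γ - α) * M.value O α g h q) s p =
        RCPath.running O γ g s p + (γ - α) * RCPath.running O γ (M.value O α g h) s p := by
      simp only [RCPath.running]
      rw [← integral_const_mul, ← integral_add (hbr hg p) ((hbr hv p).const_mul _)]
      refine integral_congr_ae (Eventually.of_forall fun u => ?_)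
      by_cases hu : u ∈ {u : ℝ≥0 | (u : ℝ≥0∞) < RCPath.exit O p}
      · simp only [Set.indicator_of_mem hu]
      · simp only [Set.indicator_of_notMem hu, mul_zero, add_zero]
    rw [RCPath.payoff, RCPath.payoff, h1]
    ring
  have hΨ := RCPath.boundedMeasurable_payoff O hα hg hh
  have hjoint : BoundedMeasurable fun r : ℝ≥0 × RCPath E =>
      {u : ℝ≥0 | (u : ℝ≥0∞) < RCPath.exit O r.2}.indicator
        (fun u => RCPath.payoff O α g h (s + u) (r.2.shift u)) r.1 :=
    (hΨ.comp (f := fun r : ℝ≥0 × RCPath E => (s + r.1, r.2.shift r.1))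
      ((measurable_const.add measurable_fst).prodMk RCPath.measurable_shift_prod)).indicator
        (RCPath.measurableSet_lt_exit O)
  -- By the Markov property at each `u` before exit, the value at `(s + u, X(u))` may be replaced by
  -- the payoff of the shifted path. After Fubini, the claim is the pathwise identity
  -- `RCPath.integral_payoff_shift`.
  have key : (γ - α) * ∫ p, RCPath.running O γ (M.value O α g h) s p ∂(M.pathLaw x) =
      ∫ p, (RCPath.payoff O α g h s p - RCPath.payoff O γ g h s p) ∂(M.pathLaw x) := by
    rw [M.value_running O hγ hv]
    have h1 : ∀ u : ℝ≥0, ∫ p in {p | (u : ℝ≥0∞) < RCPath.exit O p},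
        M.value O α g h (s + u, p.1 u) ∂(M.pathLaw x) =
        ∫ p, {u : ℝ≥0 | (u : ℝ≥0∞) < RCPath.exit O p}.indicator
          (fun u => RCPath.payoff O α g h (s + u) (p.shift u)) u ∂(M.pathLaw x) := by
      intro u
      simp only [value]
      rw [← M.integral_shift O u x (Ψ := RCPath.payoff O α g h (s + u))
        (hΨ.comp (f := fun p => (s + u, p)) (by fun_prop)),
        ← integral_indicator (RCPath.measurableSet_lt_exit_right O u)]
      rfl
    simp_rw [h1]
    rw [integral_integral_swap (integrable_of_bounded hjoint), ← integral_const_mul]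
    refine integral_congr_ae (Eventually.of_forall fun p => ?_)
    exact RCPath.integral_payoff_shift O hα hγ hg s p
  rw [value, value]
  simp only [hsplit]
  have hrun := integrable_of_bounded (μ := M.pathLaw x)
    ((RCPath.boundedMeasurable_running O hγ hv).comp (f := fun p => (s, p)) (by fun_prop))
  rw [integral_add (M.integrable_payoff O hγ hg hh s x) (hrun.const_mul _), integral_const_mul,
    key, integral_sub (M.integrable_payoff O hα hg hh s x) (M.integrable_payoff O hγ hg hh s x)]
  ring

end StandardMarkovProcess

/-! ### Potentials and the strong Markov property at the exit time -/

namespace RCPath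

variable {E : Type*} [MetricSpace E]

@[simp] lemma exit_univ (p : RCPath E) : exit Set.univ p = ⊤ := by
  simp [exit, hit]

@[simp] lemma running_zero (O : Set E) (γ : ℝ) (s : ℝ≥0) (p : RCPath E) :
    running O γ (fun _ => 0) s p = 0 := by
  simp [running]

@[simp] lemma exitPay_zero (O : Set E) (γ : ℝ) (s : ℝ≥0) (p : RCPath E) :
    exitPay O γ (fun _ => 0) s p = 0 := by
  simp [exitPay]

end RCPath

namespace StandardMarkovProcess

variable {E : Type*} [MetricSpace E] [MeasurableSpace E] [BorelSpace E]
  {Ω : Type*} [MeasurableSpace Ω] (M : StandardMarkovProcess E Ω)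

omit [BorelSpace E] in
lemma transition_eq_map_pathLaw (t : ℝ≥0) (x : E) :
    M.transition t x = (M.pathLaw x).map fun p => p.1 t := by
  rw [pathLaw_apply, Measure.map_map (RCPath.measurable_eval t) M.measurable_path, transition_apply]
  rfl

lemma value_eq_add (O : Set E) {γ : ℝ} (hγ : 0 < γ) {g h : ℝ≥0 × E → ℝ}
    (hg : BoundedMeasurable g) (hh : BoundedMeasurable h) (q : ℝ≥0 × E) :
    M.value O γ g h q = M.value O γ g (fun _ => 0) q + M.value O γ (fun _ => 0) h q := by
  rw [value, value, value, ← integral_add (M.integrable_payoff O hγ hg (.const 0) q.1 q.2)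
    (M.integrable_payoff O hγ (.const 0) hh q.1 q.2)]
  simp [RCPath.payoff]

lemma value_zero_right (O : Set E) {γ : ℝ} (hγ : 0 < γ) {g : ℝ≥0 × E → ℝ}
    (hg : BoundedMeasurable g) (s : ℝ≥0) (x : E) :
    M.value O γ g (fun _ => 0) (s, x) =
      ∫ u, ∫ p in {p | (u : ℝ≥0∞) < RCPath.exit O p}, g (s + u, p.1 u) ∂(M.pathLaw x)
        ∂(discount γ) := by
  rw [← M.value_running O hγ hg]
  simp [value, RCPath.payoff]

lemma value_univ {γ : ℝ} (hγ : 0 < γ) {g : ℝ≥0 × E → ℝ} (hg : BoundedMeasurable g)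
    (s : ℝ≥0) (x : E) :
    M.value Set.univ γ g (fun _ => 0) (s, x) =
      ∫ u, ∫ y, g (s + u, y) ∂(M.transition u x) ∂(discount γ) := by
  rw [M.value_zero_right _ hγ hg]
  refine integral_congr_ae (Eventually.of_forall fun u => ?_)
  simp only [RCPath.exit_univ, ENNReal.coe_lt_top, Set.ofPred_true, Measure.restrict_univ]
  rw [M.transition_eq_map_pathLaw, integral_map (RCPath.measurable_eval u).aemeasurable
    (hg.comp (f := fun y => (s + u, y)) (by fun_prop)).1.aestronglyMeasurable]

lemma integral_exit (O : Set E) (γ : ℝ) (h : ℝ≥0 × E → ℝ) (s : ℝ≥0) (x : E) :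
    M.value O γ (fun _ => 0) h (s, x) =
      ∫ p in {p | RCPath.exit O p ≠ ⊤}, Real.exp (-γ * (RCPath.exit O p).toNNReal) *
        h (s + (RCPath.exit O p).toNNReal, p.1 (RCPath.exit O p).toNNReal) ∂(M.pathLaw x) := by
  rw [← integral_indicator (RCPath.measurableSet_exit_ne_top O)]
  simp [value, RCPath.payoff, RCPath.exitPay]

lemma measurable_exit_toNNReal (O : Set E) :
    Measurable fun p : RCPath E => (RCPath.exit O p).toNNReal :=
  (RCPath.measurable_exit O).ennreal_toNNReal

/-- The strong Markov property at the exit time, on rectangles. -/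
lemma strongMarkov_exit_apply (O : Set E) (t : ℝ≥0) (x : E) {C : Set ℝ≥0} (hC : MeasurableSet C)
    {B : Set E} (hB : MeasurableSet B) :
    M.pathLaw x ({p | (RCPath.exit O p).toNNReal ∈ C} ∩ {p | RCPath.exit O p ≠ ⊤} ∩
        {p | p.1 ((RCPath.exit O p).toNNReal + t) ∈ B}) =
      ∫⁻ p in {p | (RCPath.exit O p).toNNReal ∈ C} ∩ {p | RCPath.exit O p ≠ ⊤},
        M.transition t (p.1 (RCPath.exit O p).toNNReal) B ∂(M.pathLaw x) := by
  have hτ := M.isStoppingTime_exitLimit O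
  -- `untopA` takes a default value where the exit time is infinite; this is harmless, since the
  -- event is always intersected with `{τ < ∞}`.
  have hA : MeasurableSet[hτ.measurableSpace] {ω | (M.exitLimit O ω).untopA ∈ C} :=
    (WithTop.measurable_untopA.comp hτ.measurable) hC
  have h := M.strongMarkov (M.exitLimit O) hτ t B hB x _ hA
  have hcoe : ∀ ω, M.exitLimit O ω < ⊤ →
      M.exitLimit O ω = ((RCPath.exit O (M.path ω)).toNNReal : WithTop ℝ≥0) := fun ω hω =>
    M.exitLimit_eq_coe_iff.2 (ENNReal.coe_toNNReal
      (fun h => hω.ne (M.exitLimit_eq_top_iff.2 h))).symm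
  have htop : ∀ ω, M.exitLimit O ω < ⊤ ↔ RCPath.exit O (M.path ω) ≠ ⊤ := fun ω =>
    lt_top_iff_ne_top.trans M.exitLimit_eq_top_iff.not
  have hset1 : {ω | (M.exitLimit O ω).untopA ∈ C} ∩ {ω | M.exitLimit O ω < ⊤} =
      M.path ⁻¹' ({p | (RCPath.exit O p).toNNReal ∈ C} ∩ {p | RCPath.exit O p ≠ ⊤}) := by
    ext ω
    simp only [Set.mem_inter_iff, Set.mem_ofPred_eq, Set.mem_preimage, ← htop]
    refine and_congr_left fun hω => ?_
    rw [hcoe ω hω]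
    rfl
  have hset2 : {ω | (M.exitLimit O ω).untopA ∈ C} ∩ {ω | M.exitLimit O ω < ⊤} ∩
      {ω | stoppedValue M.X (fun ω' => M.exitLimit O ω' + t) ω ∈ B} =
      M.path ⁻¹' ({p | (RCPath.exit O p).toNNReal ∈ C} ∩ {p | RCPath.exit O p ≠ ⊤} ∩
        {p | p.1 ((RCPath.exit O p).toNNReal + t) ∈ B}) := by
    rw [hset1]
    ext ω
    refine and_congr_right fun hω => ?_
    have hω' : M.exitLimit O ω + t = ((RCPath.exit O (M.path ω)).toNNReal + t : ℝ≥0) := by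
      rw [hcoe ω ((htop ω).2 hω.2), WithTop.coe_add]
    simp only [Set.mem_ofPred_eq]
    rw [M.stoppedValue_of_eq_coe (τ := fun ω' => M.exitLimit O ω' + t) hω']
    rfl
  have hT := measurable_exit_toNNReal (E := E) O
  have hm1 : MeasurableSet ({p : RCPath E | (RCPath.exit O p).toNNReal ∈ C} ∩
      {p | RCPath.exit O p ≠ ⊤}) := (hT hC).inter (RCPath.measurableSet_exit_ne_top O)
  have hm2 : Measurable fun p : RCPath E => p.1 ((RCPath.exit O p).toNNReal + t) :=
    RCPath.measurable_eval_prod.comp ((hT.add_const t).prodMk measurable_id)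
  have hm3 : MeasurableSet {p : RCPath E | p.1 ((RCPath.exit O p).toNNReal + t) ∈ B} := hm2 hB
  rw [hset2, hset1] at h
  rw [pathLaw_apply, Measure.map_apply M.measurable_path (hm1.inter hm3), h,
    setLIntegral_map hm1 (show Measurable fun p : RCPath E =>
      M.transition t (p.1 (RCPath.exit O p).toNNReal) B from
        ((M.transition t).measurable_coe hB).comp (RCPath.measurable_eval_exit O))
      M.measurable_path]
  refine setLIntegral_congr_fun (M.measurable_path hm1) fun ω hω => ?_
  rw [M.stoppedValue_of_eq_coe (hcoe ω ((htop ω).2 hω.2)), transition_apply,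
    Measure.map_apply (M.measurable_X t) hB]
  rfl

/-- The strong Markov property at the exit time. -/
lemma strongMarkov_exit (O : Set E) (t : ℝ≥0) (x : E) {F : ℝ≥0 × E → ℝ}
    (hF : BoundedMeasurable F) :
    ∫ p in {p | RCPath.exit O p ≠ ⊤},
        F ((RCPath.exit O p).toNNReal, p.1 ((RCPath.exit O p).toNNReal + t)) ∂(M.pathLaw x) =
      ∫ p in {p | RCPath.exit O p ≠ ⊤}, ∫ y, F ((RCPath.exit O p).toNNReal, y)
        ∂(M.transition t (p.1 (RCPath.exit O p).toNNReal)) ∂(M.pathLaw x) := by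
  have hT := measurable_exit_toNNReal (E := E) O
  set ν := (M.pathLaw x).restrict {p | RCPath.exit O p ≠ ⊤} with hν
  set κ : Kernel (RCPath E) E := (M.transition t).comap _ (RCPath.measurable_eval_exit O) with hκ
  have hm2 : Measurable fun p : RCPath E => p.1 ((RCPath.exit O p).toNNReal + t) :=
    RCPath.measurable_eval_prod.comp ((hT.add_const t).prodMk measurable_id)
  have hm1 : Measurable fun p : RCPath E =>
      ((RCPath.exit O p).toNNReal, p.1 ((RCPath.exit O p).toNNReal + t)) := hT.prodMk hm2
  have hm3 : Measurable fun r : RCPath E × E => ((RCPath.exit O r.1).toNNReal, r.2) :=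
    (hT.comp measurable_fst).prodMk measurable_snd
  have hCm : ∀ {C : Set ℝ≥0}, MeasurableSet C →
    MeasurableSet {p : RCPath E | (RCPath.exit O p).toNNReal ∈ C} := fun hC => hT hC
  -- Both sides are laws of a pair (exit time, position `t` later), so it suffices to compare them
  -- on rectangles.
  have key : ν.map (fun p => ((RCPath.exit O p).toNNReal, p.1 ((RCPath.exit O p).toNNReal + t))) =
      (ν ⊗ₘ κ).map (fun r => ((RCPath.exit O r.1).toNNReal, r.2)) := by
    refine Measure.ext_prod fun {C B} hC hB => ?_
    rw [Measure.map_apply hm1 (hC.prod hB), Measure.map_apply hm3 (hC.prod hB)]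
    have h1 : (fun r : RCPath E × E => ((RCPath.exit O r.1).toNNReal, r.2)) ⁻¹' (C ×ˢ B) =
        {p | (RCPath.exit O p).toNNReal ∈ C} ×ˢ B := rfl
    rw [h1, Measure.compProd_apply_prod (hCm hC) hB, hν, Measure.restrict_apply (hm1 (hC.prod hB)),
      Measure.restrict_restrict (hCm hC)]
    refine Eq.trans ?_ (M.strongMarkov_exit_apply O t x hC hB)
    congr 1
    ext p
    simp only [Set.mem_inter_iff, Set.mem_preimage, Set.mem_prod, Set.mem_ofPred_eq]
    tauto
  rw [← integral_map (f := F) hm1.aemeasurable hF.1.aestronglyMeasurable, key,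
    integral_map hm3.aemeasurable hF.1.aestronglyMeasurable,
    Measure.integral_compProd (integrable_of_bounded (hF.comp hm3))]
  rfl

/-- The expected exit payoff of a potential. -/
lemma value_exit_potential (O : Set E) {c : ℝ} (hc : 0 < c) {ψ : ℝ≥0 × E → ℝ}
    (hψ : BoundedMeasurable ψ) (q : ℝ≥0 × E) :
    M.value O c (fun _ => 0) (M.value Set.univ c ψ fun _ => 0) q =
      M.value Set.univ c ψ (fun _ => 0) q - M.value O c ψ (fun _ => 0) q := by
  have := isFiniteMeasure_discount hc
  obtain ⟨s, x⟩ := q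
  have hT := measurable_exit_toNNReal (E := E) O
  have hexp : BoundedMeasurable fun r : ℝ≥0 => Real.exp (-c * r) := by
    refine ⟨by fun_prop, 1, fun r => ?_⟩
    rw [abs_of_nonneg (Real.exp_nonneg _), Real.exp_le_one_iff]
    have := r.coe_nonneg
    nlinarith
  have hmul : ∀ {α : Type _} [MeasurableSpace α] {F G : α → ℝ}, BoundedMeasurable F →
      BoundedMeasurable G → BoundedMeasurable fun a => F a * G a := by
    rintro α _ F G ⟨hF, C, hC⟩ ⟨hG, D, hD⟩
    refine ⟨hF.mul hG, C * D, fun a => ?_⟩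
    rw [abs_mul]
    exact mul_le_mul (hC a) (hD a) (abs_nonneg _) ((abs_nonneg _).trans (hC a))
  have hF : ∀ t : ℝ≥0, BoundedMeasurable fun r : ℝ≥0 × E =>
      Real.exp (-c * r.1) * ψ (s + r.1 + t, r.2) := fun t =>
    hmul (hexp.comp measurable_fst) (hψ.comp (by fun_prop))
  have hjoint : BoundedMeasurable fun r : RCPath E × ℝ≥0 =>
      Real.exp (-c * (RCPath.exit O r.1).toNNReal) *
        ψ (s + (RCPath.exit O r.1).toNNReal + r.2, r.1.1 ((RCPath.exit O r.1).toNNReal + r.2)) := by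
    have h1 : Measurable fun r : RCPath E × ℝ≥0 => (RCPath.exit O r.1).toNNReal :=
      hT.comp measurable_fst
    exact hmul (hexp.comp h1) (hψ.comp (((h1.const_add s).add measurable_snd).prodMk
      (RCPath.measurable_eval_prod.comp ((h1.add measurable_snd).prodMk measurable_fst))))
  have htrans : ∀ (t : ℝ≥0) (z : E) {f : E → ℝ}, Measurable f →
      ∫ y, f y ∂(M.transition t z) = ∫ p, f (p.1 t) ∂(M.pathLaw z) := fun t z f hf => by
    rw [M.transition_eq_map_pathLaw, integral_map (RCPath.measurable_eval t).aemeasurable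
      hf.aestronglyMeasurable]
  have hψ1 : ∀ r : ℝ≥0, Measurable fun y => ψ (r, y) := fun r => hψ.1.comp (by fun_prop)
  -- Each `M.transition t` is a kernel for a fixed `t` only. Joint measurability in `t` is obtained
  -- by rewriting the inner integral over `pathLaw`, where `t` enters through the jointly measurable
  -- evaluation.
  have hjoint' : BoundedMeasurable fun r : RCPath E × ℝ≥0 =>
      ∫ y, Real.exp (-c * (RCPath.exit O r.1).toNNReal) *
        ψ (s + (RCPath.exit O r.1).toNNReal + r.2, y)
          ∂(M.transition r.2 (r.1.1 (RCPath.exit O r.1).toNNReal)) := by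
    have h1 : Measurable fun r : (RCPath E × ℝ≥0) × RCPath E => (RCPath.exit O r.1.1).toNNReal :=
      hT.comp measurable_fst.fst
    have h2 := (hmul (hexp.comp h1) (hψ.comp
      (f := fun r : (RCPath E × ℝ≥0) × RCPath E =>
        (s + (RCPath.exit O r.1.1).toNNReal + r.1.2, r.2.1 r.1.2))
      (((h1.const_add s).add measurable_fst.snd).prodMk (RCPath.measurable_eval_prod.comp
        (measurable_fst.snd.prodMk measurable_snd))))).integral_kernel (M.pathLaw.comap
          (fun r : RCPath E × ℝ≥0 => r.1.1 (RCPath.exit O r.1).toNNReal)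
          ((RCPath.measurable_eval_exit O).comp measurable_fst))
    simp only [Kernel.comap_apply] at h2
    simpa only [htrans _ _ ((hψ1 _).const_mul _)] using h2
  have hswap : ∫ p in {p | RCPath.exit O p ≠ ⊤}, Real.exp (-c * (RCPath.exit O p).toNNReal) *
      M.value Set.univ c ψ (fun _ => 0) (s + (RCPath.exit O p).toNNReal,
        p.1 (RCPath.exit O p).toNNReal) ∂(M.pathLaw x) =
      ∫ p in {p | RCPath.exit O p ≠ ⊤}, ∫ t, Real.exp (-c * (RCPath.exit O p).toNNReal) *
        ψ (s + (RCPath.exit O p).toNNReal + t, p.1 ((RCPath.exit O p).toNNReal + t))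
          ∂(discount c) ∂(M.pathLaw x) := by
    simp only [M.value_univ hc hψ, ← integral_const_mul]
    conv_lhs => rw [integral_integral_swap (integrable_of_bounded hjoint')]
    conv_rhs => rw [integral_integral_swap (integrable_of_bounded hjoint)]
    exact integral_congr_ae (Eventually.of_forall fun t => (M.strongMarkov_exit O t x (hF t)).symm)
  have hFp : ∀ p : RCPath E, BoundedMeasurable fun u => ψ (s + u, p.1 u) := fun p =>
    hψ.comp ((measurable_const.add measurable_id).prodMk
      (RCPath.measurable_eval_prod.comp (measurable_id.prodMk measurable_const)))
  -- Discounting by `e^{-cτ}` and restarting the clock at `τ` produces the part of the discounted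
  -- integral after `τ`: the unstopped integral minus the stopped one.
  have hpath : ∀ p ∈ {p : RCPath E | RCPath.exit O p ≠ ⊤},
      ∫ t, Real.exp (-c * (RCPath.exit O p).toNNReal) *
        ψ (s + (RCPath.exit O p).toNNReal + t, p.1 ((RCPath.exit O p).toNNReal + t))
          ∂(discount c) =
      RCPath.running Set.univ c ψ s p - RCPath.running O c ψ s p := by
    intro p hp
    have hset : {u : ℝ≥0 | (u : ℝ≥0∞) < RCPath.exit O p} =
        (Set.Ici (RCPath.exit O p).toNNReal)ᶜ := by
      ext u
      rw [Set.compl_Ici, Set.mem_Iio, ← ENNReal.coe_lt_coe, ENNReal.coe_toNNReal hp]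
      rfl
    rw [integral_const_mul]
    simp only [add_assoc]
    rw [integral_discount_shift c _ (hFp p).1, RCPath.running, RCPath.running, hset,
      integral_indicator measurableSet_Ici.compl,
      setIntegral_compl measurableSet_Ici (integrable_of_bounded (hFp p))]
    simp
  have hzero : ∀ p : RCPath E, p ∉ {p : RCPath E | RCPath.exit O p ≠ ⊤} →
      RCPath.running Set.univ c ψ s p - RCPath.running O c ψ s p = 0 := by
    intro p hp
    have hp' : RCPath.exit O p = ⊤ := not_not.1 hp
    simp [RCPath.running, hp']
  have hint : ∀ O', Integrable (RCPath.running O' c ψ s) (M.pathLaw x) := fun O' =>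
    integrable_of_bounded ((RCPath.boundedMeasurable_running O' hc hψ).comp
      (f := fun p => (s, p)) (by fun_prop))
  rw [M.integral_exit, hswap, setIntegral_congr_fun (RCPath.measurableSet_exit_ne_top O) hpath,
    setIntegral_eq_integral_of_forall_compl_eq_zero hzero, integral_sub (hint _) (hint _)]
  simp [value, RCPath.payoff]

end StandardMarkovProcess

/-! ### Vague convergence of finite measures -/

section VagueConvergence

variable {Y : Type*} [MetricSpace Y] [ProperSpace Y]

/-- A cut-off function for a compact set. -/
lemma exists_cutoff {K : Set Y} (hK : IsCompact K) :
    ∃ χ : C_c(Y, ℝ), (∀ y ∈ K, χ y = 1) ∧ ∀ y, 0 ≤ χ y ∧ χ y ≤ 1 := by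
  obtain ⟨f, h1, -, hc, h01⟩ :=
    exists_continuous_one_zero_of_isCompact hK isClosed_empty (Set.disjoint_empty K)
  exact ⟨⟨f, hc⟩, fun y hy => h1 hy, fun y => h01 y⟩

lemma exists_compactlySupported_approx (g : C₀(Y, ℝ)) {ε : ℝ} (hε : 0 < ε) :
    ∃ h : C_c(Y, ℝ), ∀ y, |g y - h y| ≤ ε := by
  have h0 : ∀ᶠ y in cocompact Y, |g y| < ε := by
    have := (zero_at_infty g).eventually (Metric.ball_mem_nhds 0 hε)
    simpa using this
  obtain ⟨K, hK, hKg⟩ := mem_cocompact.1 h0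
  obtain ⟨χ, h1, h01⟩ := exists_cutoff hK
  refine ⟨⟨⟨fun y => g y * χ y, by fun_prop⟩, χ.hasCompactSupport.mul_left⟩, fun y => ?_⟩
  change |g y - g y * χ y| ≤ ε
  by_cases hy : y ∈ K
  · simp [h1 y hy, hε.le]
  · have h2 : |g y| < ε := hKg hy
    have h3 : g y - g y * χ y = g y * (1 - χ y) := by ring
    rw [h3, abs_mul, abs_of_nonneg (sub_nonneg.2 (h01 y).2)]
    exact (mul_le_of_le_one_right (abs_nonneg _) (by linarith [(h01 y).1])).trans h2.le

section Integrable

variable {Y : Type*} [MetricSpace Y] [MeasurableSpace Y] [BorelSpace Y]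

lemma integrable_of_continuous_of_bounded {μ : Measure Y} [IsFiniteMeasure μ] {F : Y → ℝ}
    (hF : Continuous F) {C : ℝ} (hC : ∀ y, |F y| ≤ C) : Integrable F μ :=
  integrable_of_bounded ⟨hF.measurable, C, hC⟩

lemma CompactlySupportedContinuousMap.integrable' {μ : Measure Y} [IsFiniteMeasure μ]
    (h : C_c(Y, ℝ)) : Integrable h μ :=
  h.continuous.integrable_of_hasCompactSupport h.hasCompactSupport

lemma ZeroAtInftyContinuousMap.integrable' {μ : Measure Y} [IsFiniteMeasure μ]
    (g : C₀(Y, ℝ)) : Integrable g μ :=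
  integrable_of_bounded (BoundedContinuousFunction.boundedMeasurable g.toBCF)

end Integrable

variable [MeasurableSpace Y] [BorelSpace Y]

variable {Z : Type*} {μ : Z → Measure Y} [∀ z, IsFiniteMeasure (μ z)]

/-- Vague convergence and convergence of the total mass imply convergence of the integrals of
bounded continuous functions that depend continuously on the parameter. -/
lemma tendsto_integral_of_vague [TopologicalSpace Z] {z₀ : Z}
    (hv : ∀ h : C_c(Y, ℝ), Tendsto (fun z => ∫ y, h y ∂(μ z)) (𝓝 z₀) (𝓝 (∫ y, h y ∂(μ z₀))))
    (hm : Tendsto (fun z => (μ z).real Set.univ) (𝓝 z₀) (𝓝 ((μ z₀).real Set.univ)))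
    {F : Z × Y → ℝ} (hF : Continuous F) {C : ℝ} (hC : ∀ q, |F q| ≤ C) :
    Tendsto (fun z => ∫ y, F (z, y) ∂(μ z)) (𝓝 z₀) (𝓝 (∫ y, F (z₀, y) ∂(μ z₀))) := by
  have hFz : ∀ z, Continuous fun y => F (z, y) := fun z => hF.comp (by fun_prop)
  have hFint : ∀ z, Integrable (fun y => F (z, y)) (μ z) := fun z =>
    integrable_of_continuous_of_bounded (hFz z) fun y => hC (z, y)
  -- The bound forces `C ≥ 0` only if there is a point; on an empty space all the integrals vanish.
  have hC0 : 0 ≤ C ∨ IsEmpty Y := by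
    rcases isEmpty_or_nonempty Y with h | ⟨⟨y⟩⟩
    · exact Or.inr h
    · exact Or.inl ((abs_nonneg _).trans (hC (z₀, y)))
  rcases hC0 with hC0 | hY
  swap
  · simp [Measure.eq_zero_of_isEmpty]
  rw [Metric.tendsto_nhds]
  intro δ hδ
  set m := (μ z₀).real Set.univ with hmdef
  have hm0 : 0 ≤ m := measureReal_nonneg
  -- The term `ε * m` pays for replacing `F (z, ·)` by `F (z₀, ·)` on the support of the cut-off;
  -- each `C * ε` pays for the mass outside the cut-off, once for `μ z` in the limit and once for `μ
  -- z₀`.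
  obtain ⟨ε, hε, hεδ⟩ : ∃ ε : ℝ, 0 < ε ∧ ε * m + C * ε + C * ε < δ := by
    refine ⟨δ / (2 * (m + 2 * C + 1)), by positivity, ?_⟩
    have h2 : 0 < m + 2 * C + 1 := by positivity
    have : δ / (2 * (m + 2 * C + 1)) * m + C * (δ / (2 * (m + 2 * C + 1))) +
        C * (δ / (2 * (m + 2 * C + 1))) = δ / 2 * ((m + 2 * C) / (m + 2 * C + 1)) := by
      field_simp
      ring
    rw [this]
    have h3 : (m + 2 * C) / (m + 2 * C + 1) ≤ 1 := by
      rw [div_le_one h2]; linarith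
    nlinarith
  obtain ⟨K, -, hK, hKm⟩ := MeasurableSet.univ.exists_isCompact_lt_add (μ := μ z₀)
    (measure_ne_top _ _) (ε := ENNReal.ofReal ε) (by simpa using hε)
  obtain ⟨χ, h1, h01⟩ := exists_cutoff hK
  have hχint : ∀ z, Integrable χ (μ z) := fun z => χ.integrable'
  have hφ : ∀ z, ∫ y, (1 - χ y) ∂(μ z) = (μ z).real Set.univ - ∫ y, χ y ∂(μ z) := fun z => by
    rw [integral_sub (integrable_const _) (hχint z)]
    simp
  have hφ0 : ∫ y, (1 - χ y) ∂(μ z₀) ≤ ε := by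
    have h2 : (μ z₀).real K ≤ ∫ y, χ y ∂(μ z₀) := by
      rw [← integral_indicator_one hK.measurableSet]
      refine integral_mono ((integrable_const (1 : ℝ)).indicator hK.measurableSet) (hχint z₀) ?_
      intro y
      by_cases hy : y ∈ K
      · simp [hy, h1 y hy]
      · simpa [hy] using (h01 y).1
    have h3 : m ≤ (μ z₀).real K + ε := by
      have := ENNReal.toReal_mono (by finiteness) hKm.le
      rwa [ENNReal.toReal_add (measure_ne_top _ _) ENNReal.ofReal_ne_top,
        ENNReal.toReal_ofReal hε.le] at this
    rw [hφ]
    linarith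
  -- Here convergence of the total mass is used: it prevents mass from escaping to infinity as `z →
  -- z₀`.
  have hφlim : Tendsto (fun z => ∫ y, (1 - χ y) ∂(μ z)) (𝓝 z₀) (𝓝 (∫ y, (1 - χ y) ∂(μ z₀))) := by
    simp_rw [hφ]
    exact hm.sub (hv χ)
  let k : C_c(Y, ℝ) := ⟨⟨fun y => F (z₀, y) * χ y, (hFz z₀).mul χ.continuous⟩,
    χ.hasCompactSupport.mul_left⟩
  have hk : ∀ y, k y = F (z₀, y) * χ y := fun y => rfl
  have hunif : ∀ᶠ z in 𝓝 z₀, ∀ y ∈ tsupport χ, |F (z, y) - F (z₀, y)| < ε := by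
    refine χ.hasCompactSupport.isCompact.eventually_forall_of_forall_eventually
      (P := fun z y => |F (z, y) - F (z₀, y)| < ε) fun y _ => ?_
    have hc : Continuous fun q : Z × Y => |F (q.1, q.2) - F (z₀, q.2)| := by fun_prop
    exact hc.continuousAt.eventually (isOpen_Iio.mem_nhds (by simpa using hε))
  have hest : ∀ z, (∀ y ∈ tsupport χ, |F (z, y) - F (z₀, y)| < ε) →
      |∫ y, F (z, y) ∂(μ z) - ∫ y, k y ∂(μ z)| ≤
        ε * (μ z).real Set.univ + C * ∫ y, (1 - χ y) ∂(μ z) := by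
    intro z hz
    rw [← integral_sub (hFint z) k.integrable', ← integral_const_mul]
    have h2 : ε * (μ z).real Set.univ = ∫ _, ε ∂(μ z) := by simp [mul_comm]
    have h3 : Integrable (fun y => C * (1 - χ y)) (μ z) :=
      ((integrable_const 1).sub (hχint z)).const_mul C
    rw [h2, ← integral_add (integrable_const _) h3]
    refine (abs_integral_le_integral_abs).trans ?_
    refine integral_mono ((hFint z).sub k.integrable').abs ((integrable_const _).add h3) fun y => ?_
    have h4 : F (z, y) - k y = (F (z, y) - F (z₀, y)) * χ y + F (z, y) * (1 - χ y) := by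
      rw [hk]; ring
    simp only
    rw [h4]
    refine (abs_add_le _ _).trans (add_le_add ?_ ?_)
    · rw [abs_mul, abs_of_nonneg (h01 y).1]
      by_cases hy : y ∈ tsupport χ
      · exact (mul_le_of_le_one_right (abs_nonneg _) (h01 y).2).trans (hz y hy).le
      · rw [image_eq_zero_of_notMem_tsupport hy, mul_zero]; exact hε.le
    · rw [abs_mul, abs_of_nonneg (sub_nonneg.2 (h01 y).2)]
      exact mul_le_mul_of_nonneg_right (hC _) (sub_nonneg.2 (h01 y).2)
  have hest0 : |∫ y, k y ∂(μ z₀) - ∫ y, F (z₀, y) ∂(μ z₀)| ≤ C * ∫ y, (1 - χ y) ∂(μ z₀) := by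
    rw [← integral_sub k.integrable' (hFint z₀), ← integral_const_mul]
    refine (abs_integral_le_integral_abs).trans ?_
    refine integral_mono (k.integrable'.sub (hFint z₀)).abs
      (((integrable_const 1).sub (hχint z₀)).const_mul C) fun y => ?_
    have h4 : k y - F (z₀, y) = -(F (z₀, y) * (1 - χ y)) := by rw [hk]; ring
    simp only
    rw [h4, abs_neg, abs_mul, abs_of_nonneg (sub_nonneg.2 (h01 y).2)]
    exact mul_le_mul_of_nonneg_right (hC _) (sub_nonneg.2 (h01 y).2)
  have hlim : Tendsto (fun z => ε * (μ z).real Set.univ + C * ∫ y, (1 - χ y) ∂(μ z) +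
      |∫ y, k y ∂(μ z) - ∫ y, k y ∂(μ z₀)| + C * ∫ y, (1 - χ y) ∂(μ z₀)) (𝓝 z₀)
      (𝓝 (ε * m + C * ∫ y, (1 - χ y) ∂(μ z₀) +
        |∫ y, k y ∂(μ z₀) - ∫ y, k y ∂(μ z₀)| + C * ∫ y, (1 - χ y) ∂(μ z₀))) :=
    (((hm.const_mul ε).add (hφlim.const_mul C)).add
      (((hv k).sub tendsto_const_nhds).abs)).add tendsto_const_nhds
  have hlt : ε * m + C * ∫ y, (1 - χ y) ∂(μ z₀) +
        |∫ y, k y ∂(μ z₀) - ∫ y, k y ∂(μ z₀)| + C * ∫ y, (1 - χ y) ∂(μ z₀) < δ := by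
    rw [sub_self, abs_zero, add_zero]
    have := mul_le_mul_of_nonneg_left hφ0 hC0
    linarith
  filter_upwards [hunif, hlim.eventually (isOpen_Iio.mem_nhds hlt)] with z hz hzδ
  rw [Real.dist_eq]
  have h5 := hest z hz
  have h6 : ∫ y, F (z, y) ∂(μ z) - ∫ y, F (z₀, y) ∂(μ z₀) =
      (∫ y, F (z, y) ∂(μ z) - ∫ y, k y ∂(μ z)) + (∫ y, k y ∂(μ z) - ∫ y, k y ∂(μ z₀)) +
        (∫ y, k y ∂(μ z₀) - ∫ y, F (z₀, y) ∂(μ z₀)) := by ring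
  rw [h6]
  refine (abs_add_le _ _).trans_lt ?_
  have h7 := abs_add_le (∫ y, F (z, y) ∂(μ z) - ∫ y, k y ∂(μ z))
    (∫ y, k y ∂(μ z) - ∫ y, k y ∂(μ z₀))
  have h8 : _ < δ := hzδ
  linarith

/-- Vague compactness: along an ultrafilter, finite measures of bounded mass converge vaguely. -/
lemma exists_vague_limit {C : ℝ} (hC : ∀ z, (μ z).real Set.univ ≤ C) (U : Ultrafilter Z) :
    ∃ ν : Measure Y, IsFiniteMeasure ν ∧ ∀ h : C_c(Y, ℝ),
      Tendsto (fun z => ∫ y, h y ∂(μ z)) U (𝓝 (∫ y, h y ∂ν)) := by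
  have hbd : ∀ (h : C_c(Y, ℝ)) (B : ℝ), (∀ y, |h y| ≤ B) → ∀ z, |∫ y, h y ∂(μ z)| ≤ |B| * C := by
    intro h B hB z
    have h1 : ∀ y, ‖h y‖ ≤ |B| := fun y => (hB y).trans (le_abs_self B)
    exact (norm_integral_le_of_norm_le_const (Eventually.of_forall h1)).trans
      (mul_le_mul_of_nonneg_left (hC z) (abs_nonneg B))
  have L : ∀ h : C_c(Y, ℝ), ∃ a, Tendsto (fun z => ∫ y, h y ∂(μ z)) U (𝓝 a) := by
    intro h
    obtain ⟨B, hB⟩ := h.hasCompactSupport.exists_bound_of_continuous h.continuous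
    have hmem : ∀ z, ∫ y, h y ∂(μ z) ∈ Set.Icc (-(|B| * C)) (|B| * C) := fun z =>
      abs_le.1 (hbd h B hB z)
    obtain ⟨a, -, ha⟩ := isCompact_Icc.ultrafilter_le_nhds
      (U.map fun z => ∫ y, h y ∂(μ z)) (by
        rw [le_principal_iff, Ultrafilter.coe_map, Filter.mem_map]
        exact Eventually.of_forall hmem)
    exact ⟨a, ha⟩
  choose Λ hΛ using L
  -- Limits along the ultrafilter inherit linearity and monotonicity from the integrals, so the
  -- Riesz representation theorem supplies the limit measure.
  let Λ' : C_c(Y, ℝ) →ₚ[ℝ] ℝ :=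
  { toFun := Λ
    map_add' g g' := by
      have : Tendsto (fun z => ∫ y, (g y + g' y) ∂(μ z)) U (𝓝 (Λ g + Λ g')) := by
        refine ((hΛ g).add (hΛ g')).congr fun z => ?_
        rw [integral_add g.integrable' g'.integrable']
      exact tendsto_nhds_unique (hΛ (g + g')) this
    map_smul' c g := by
      have : Tendsto (fun z => ∫ y, c • g y ∂(μ z)) U (𝓝 (c • Λ g)) := by
        refine ((hΛ g).const_smul c).congr fun z => ?_
        rw [integral_smul]
      exact tendsto_nhds_unique (hΛ (c • g)) this
    monotone' g g' hgg' :=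
      le_of_tendsto_of_tendsto' (hΛ g) (hΛ g') fun z =>
        integral_mono g.integrable' g'.integrable' hgg' }
  -- The mass of a compact set is at most the limit of the integrals of a cut-off, hence at most
  -- `C`; inner regularity extends the bound to the whole space.
  have hfin : IsFiniteMeasure (RealRMK.rieszMeasure Λ') := by
    refine ⟨lt_of_le_of_lt (b := ENNReal.ofReal C) ?_ ENNReal.ofReal_lt_top⟩
    rw [isOpen_univ.measure_eq_iSup_isCompact]
    refine iSup₂_le fun K _ => iSup_le fun hK => ?_
    obtain ⟨χ, h1, h01⟩ := exists_cutoff hK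
    refine (RealRMK.rieszMeasure_le_of_eq_one Λ' (fun y => (h01 y).1) hK h1).trans
      (ENNReal.ofReal_le_ofReal ?_)
    refine le_of_tendsto (hΛ χ) (Eventually.of_forall fun z => ?_)
    refine (integral_mono (χ.integrable' (μ := μ z)) (integrable_const (1 : ℝ))
      fun y => (h01 y).2).trans ?_
    simpa using hC z
  refine ⟨RealRMK.rieszMeasure Λ', hfin, fun h => ?_⟩
  rw [RealRMK.integral_rieszMeasure]
  exact hΛ h

/-- The uniform mass bound makes uniform approximation by compactly supported functions uniform in
`z`. -/
lemma tendsto_integral_zeroAtInfty {C : ℝ} (hC : ∀ z, (μ z).real Set.univ ≤ C) {l : Filter Z}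
    {ν : Measure Y} [IsFiniteMeasure ν]
    (h : ∀ h : C_c(Y, ℝ), Tendsto (fun z => ∫ y, h y ∂(μ z)) l (𝓝 (∫ y, h y ∂ν)))
    (g : C₀(Y, ℝ)) : Tendsto (fun z => ∫ y, g y ∂(μ z)) l (𝓝 (∫ y, g y ∂ν)) := by
  rw [Metric.tendsto_nhds]
  intro δ hδ
  set D := |C| + ν.real Set.univ + 1 with hD
  have hν : 0 ≤ ν.real Set.univ := measureReal_nonneg
  have hD0 : 0 < D := by positivity
  obtain ⟨k, hk⟩ := exists_compactlySupported_approx g (ε := δ / (2 * D)) (by positivity)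
  have hdiff : ∀ (ρ : Measure Y) [IsFiniteMeasure ρ],
      |∫ y, g y ∂ρ - ∫ y, k y ∂ρ| ≤ δ / (2 * D) * ρ.real Set.univ := by
    intro ρ _
    rw [← integral_sub g.integrable' k.integrable']
    exact norm_integral_le_of_norm_le_const (f := fun y => g y - k y) (Eventually.of_forall hk)
  filter_upwards [(h k).eventually (Metric.ball_mem_nhds _ (half_pos hδ))] with z hz
  rw [Real.dist_eq] at hz ⊢
  have h1 := hdiff (μ z)
  have h2 := hdiff ν
  have h3 : δ / (2 * D) * (μ z).real Set.univ ≤ δ / (2 * D) * |C| := by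
    gcongr; exact (hC z).trans (le_abs_self C)
  have h4 : δ / (2 * D) * |C| + δ / (2 * D) * ν.real Set.univ < δ / 2 := by
    rw [← mul_add, div_mul_eq_mul_div, div_lt_iff₀ (by positivity)]
    have : |C| + ν.real Set.univ < D := by rw [hD]; linarith
    nlinarith
  have h5 : ∫ y, g y ∂(μ z) - ∫ y, g y ∂ν = (∫ y, g y ∂(μ z) - ∫ y, k y ∂(μ z)) +
    (∫ y, k y ∂(μ z) - ∫ y, k y ∂ν) - (∫ y, g y ∂ν - ∫ y, k y ∂ν) := by ring
  rw [h5]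
  have h6 := abs_sub ((∫ y, g y ∂(μ z) - ∫ y, k y ∂(μ z)) +
    (∫ y, k y ∂(μ z) - ∫ y, k y ∂ν)) (∫ y, g y ∂ν - ∫ y, k y ∂ν)
  have h7 := abs_add_le (∫ y, g y ∂(μ z) - ∫ y, k y ∂(μ z)) (∫ y, k y ∂(μ z) - ∫ y, k y ∂ν)
  linarith

/-- Vague convergence can be tested on a class of functions vanishing at infinity that is dense for
bounded pointwise convergence. -/
lemma vague_of_dense [TopologicalSpace Z] {z₀ : Z} {C : ℝ} (hC : ∀ z, (μ z).real Set.univ ≤ C)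
    (hD : ∀ h : C_c(Y, ℝ), ∃ (g : ℕ → C₀(Y, ℝ)) (B : ℝ), (∀ n y, |g n y| ≤ B) ∧
      (∀ y, Tendsto (fun n => g n y) atTop (𝓝 (h y))) ∧
      ∀ n, Tendsto (fun z => ∫ y, g n y ∂(μ z)) (𝓝 z₀) (𝓝 (∫ y, g n y ∂(μ z₀))))
    (h : C_c(Y, ℝ)) : Tendsto (fun z => ∫ y, h y ∂(μ z)) (𝓝 z₀) (𝓝 (∫ y, h y ∂(μ z₀))) := by
  rw [tendsto_iff_ultrafilter]
  intro U hU
  obtain ⟨ν, hν, hνU⟩ := exists_vague_limit hC U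
  obtain ⟨g, B, hB, hgh, hg⟩ := hD h
  have h1 : ∀ n, ∫ y, g n y ∂ν = ∫ y, g n y ∂(μ z₀) := fun n =>
    tendsto_nhds_unique (tendsto_integral_zeroAtInfty hC hνU (g n)) ((hg n).mono_left hU)
  have h2 : ∀ (ρ : Measure Y) [IsFiniteMeasure ρ],
      Tendsto (fun n => ∫ y, g n y ∂ρ) atTop (𝓝 (∫ y, h y ∂ρ)) := fun ρ _ =>
    tendsto_integral_of_dominated_convergence (fun _ => B)
      (fun n => (g n).integrable'.aestronglyMeasurable) (integrable_const B)
      (fun n => Eventually.of_forall (hB n)) (Eventually.of_forall hgh)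
  -- The ultrafilter limit `ν` and `μ z₀` agree on every `g n`, and bounded pointwise convergence
  -- carries this over to `h`. Thus every ultrafilter gives the same limit.
  have h3 : ∫ y, h y ∂ν = ∫ y, h y ∂(μ z₀) := by
    refine tendsto_nhds_unique (h2 ν) ?_
    simp_rw [h1]
    exact h2 (μ z₀)
  rw [← h3]
  exact hνU h

end VagueConvergence

/-! ### Continuity of potentials and of the stopped semigroup -/

/-- The measures `n e^{-(c + n) u} du` form an approximate identity at `0`. -/
lemma tendsto_mul_integral_discount {c : ℝ} (hc : 0 < c) {F : ℝ≥0 → ℝ} (hF : BoundedMeasurable F)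
    (hF0 : ContinuousAt F 0) :
    Tendsto (fun n : ℕ => (n : ℝ) * ∫ u, F u ∂(discount (c + n))) atTop (𝓝 (F 0)) := by
  obtain ⟨hFm, B, hB⟩ := hF
  -- After the substitution `u = v / n` the weight is `e^{-v} e^{-cv/n}`, dominated by the fixed
  -- density `e^{-v}`, while the argument of `F` tends to `0`.
  have hlim : Tendsto (fun n : ℕ => ∫ v in Set.Ioi (0 : ℝ),
      Real.exp (-v) * Real.exp (-c * ((n : ℝ)⁻¹ * v)) * F ((n : ℝ)⁻¹ * v).toNNReal) atTop
      (𝓝 (∫ v in Set.Ioi (0 : ℝ), Real.exp (-v) * F 0)) := by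
    refine tendsto_integral_of_dominated_convergence (fun v => Real.exp (-v) * B) (fun n => ?_) ?_
      (fun n => ?_) ?_
    · have h1 : Measurable fun v : ℝ => F ((n : ℝ)⁻¹ * v).toNNReal := hFm.comp (by fun_prop)
      exact ((by fun_prop : Measurable fun v : ℝ =>
        Real.exp (-v) * Real.exp (-c * ((n : ℝ)⁻¹ * v))).mul h1).aestronglyMeasurable
    · have := integrableOn_exp_mul_Ioi (a := -1) (by norm_num) 0
      simp only [neg_one_mul] at this
      exact this.mul_const B
    · filter_upwards [ae_restrict_mem measurableSet_Ioi] with v hv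
      have hv0 : (0 : ℝ) < v := hv
      have h1 : Real.exp (-c * ((n : ℝ)⁻¹ * v)) ≤ 1 := by
        rw [Real.exp_le_one_iff]
        have : 0 ≤ c * ((n : ℝ)⁻¹ * v) := by positivity
        linarith
      rw [norm_mul, norm_mul, Real.norm_of_nonneg (Real.exp_nonneg _),
        Real.norm_of_nonneg (Real.exp_nonneg _)]
      exact mul_le_mul (mul_le_of_le_one_right (Real.exp_nonneg _) h1) (hB _) (norm_nonneg _)
        (Real.exp_nonneg _)
    · refine Eventually.of_forall fun v => ?_
      have h1 : Tendsto (fun n : ℕ => (n : ℝ)⁻¹ * v) atTop (𝓝 0) := by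
        simpa using (tendsto_inv_atTop_nhds_zero_nat (𝕜 := ℝ)).mul_const v
      have h2 : Tendsto (fun n : ℕ => F ((n : ℝ)⁻¹ * v).toNNReal) atTop (𝓝 (F 0)) := by
        have h3 : Tendsto (fun n : ℕ => ((n : ℝ)⁻¹ * v).toNNReal) atTop (𝓝 0) := by
          have := (continuous_real_toNNReal.tendsto 0).comp h1
          rwa [Real.toNNReal_zero] at this
        exact hF0.tendsto.comp h3
      have h4 : Tendsto (fun n : ℕ => Real.exp (-c * ((n : ℝ)⁻¹ * v))) atTop (𝓝 1) := by
        have := (Real.continuous_exp.tendsto _).comp (h1.const_mul (-c))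
        simpa [Function.comp_def] using this
      simpa using ((tendsto_const_nhds (x := Real.exp (-v))).mul h4).mul h2
  have hval : ∫ v in Set.Ioi (0 : ℝ), Real.exp (-v) * F 0 = F 0 := by
    rw [integral_mul_const, integral_exp_neg_Ioi_zero, one_mul]
  rw [hval] at hlim
  refine hlim.congr' ?_
  filter_upwards [eventually_gt_atTop 0] with n hn
  have hn' : (0 : ℝ) < n := by exact_mod_cast hn
  rw [integral_discount _ hFm]
  have := integral_comp_mul_left_Ioi (fun v => Real.exp (-v) * Real.exp (-c * ((n : ℝ)⁻¹ * v)) *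
    F ((n : ℝ)⁻¹ * v).toNNReal) 0 hn'
  rw [mul_zero, smul_eq_mul] at this
  have h2 : ∫ v in Set.Ioi (0 : ℝ), Real.exp (-v) * Real.exp (-c * ((n : ℝ)⁻¹ * v)) *
    F ((n : ℝ)⁻¹ * v).toNNReal = n * ∫ u in Set.Ioi (0 : ℝ), Real.exp (-(n * u)) *
      Real.exp (-c * ((n : ℝ)⁻¹ * (n * u))) * F ((n : ℝ)⁻¹ * (n * u)).toNNReal := by
    rw [this, ← mul_assoc, mul_inv_cancel₀ hn'.ne', one_mul]
  rw [h2]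
  congr 1
  refine integral_congr_ae (Eventually.of_forall fun u => ?_)
  simp only [inv_mul_cancel_left₀ hn'.ne', ← Real.exp_add]
  ring_nf

/-- Dominated convergence along a filter needs countable generation; this is used to let the
starting point tend to infinity. -/
lemma isCountablyGenerated_cocompact (Y : Type*) [MetricSpace Y] [ProperSpace Y] :
    (cocompact Y).IsCountablyGenerated := by
  rcases isEmpty_or_nonempty Y with h | ⟨⟨y⟩⟩
  · rw [cocompact_eq_bot]
    infer_instance
  · rw [← Metric.cobounded_eq_cocompact, ← Metric.comap_dist_left_atTop y]
    infer_instance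

namespace StandardMarkovProcess

variable {E : Type*} [MetricSpace E] [ProperSpace E] [MeasurableSpace E] [BorelSpace E]
  {Ω : Type*} [MeasurableSpace Ω] {M : StandardMarkovProcess E Ω}

omit [ProperSpace E] in
lemma WeakFeller.exists_zeroAtInfty (hM : M.WeakFeller) (t : ℝ≥0) (h : C₀(E, ℝ)) :
    ∃ g : C₀(E, ℝ), ∀ x, g x = ∫ y, h y ∂(M.transition t x) := by
  obtain ⟨g, hg⟩ := hM t h
  refine ⟨g, fun x => ?_⟩
  rw [hg, transition_apply, integral_map (M.measurable_X t).aemeasurable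
    (f := fun y => h y) (map_continuous h).measurable.aestronglyMeasurable]

/-- The weak Feller property gives vague continuity of `x ↦ Pₜ(x, ·)`. The process is conservative,
so the mass is constantly `1` and the convergence extends to bounded functions. -/
lemma WeakFeller.continuous_transition (hM : M.WeakFeller) (t : ℝ≥0) (g : (ℝ≥0 × E) →ᵇ ℝ) :
    Continuous fun q : ℝ≥0 × E => ∫ y, g (q.1 + t, y) ∂(M.transition t q.2) := by
  rw [continuous_iff_continuousAt]
  intro q₀
  refine tendsto_integral_of_vague (Z := ℝ≥0 × E) (μ := fun q => M.transition t q.2) (z₀ := q₀)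
    (fun h => ?_) (by simp) (F := fun r => g (r.1.1 + t, r.2)) (by fun_prop)
    (C := ‖g‖) (fun r => g.norm_coe_le_norm _)
  obtain ⟨k, hk⟩ := hM.exists_zeroAtInfty t (h : C₀(E, ℝ))
  have : (fun q : ℝ≥0 × E => ∫ y, h y ∂(M.transition t q.2)) = fun q => k q.2 := by
    ext q
    exact (hk q.2).symm
  have hc : Continuous fun q : ℝ≥0 × E => ∫ y, h y ∂(M.transition t q.2) := by
    rw [this]; fun_prop
  exact hc.continuousAt

/-- (A1) gives vague continuity of the stopped transition measures and, with `h = 1`, continuity of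
their mass. That is enough for integrands that also depend on the starting time. -/
lemma StoppedFeller.continuous_stopped {O : Set E} (hO : IsOpen O) (hM : M.StoppedFeller O)
    {t : ℝ≥0} (ht : 0 < t) (g : (ℝ≥0 × E) →ᵇ ℝ) :
    Continuous fun q : ℝ≥0 × E => ∫ p in {p | (t : ℝ≥0∞) < RCPath.exit O p},
      g (q.1 + t, p.1 t) ∂(M.pathLaw q.2) := by
  have hm := RCPath.measurableSet_lt_exit_right O t
  set μ : ℝ≥0 × E → Measure E := fun q =>
    ((M.pathLaw q.2).restrict {p | (t : ℝ≥0∞) < RCPath.exit O p}).map fun p => p.1 t with hμ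
  have hfin : ∀ q, IsFiniteMeasure (μ q) := fun q => Measure.isFiniteMeasure_map _ _
  have hint : ∀ q {h : E → ℝ}, Measurable h → ∫ y, h y ∂(μ q) =
      ∫ p in {p | (t : ℝ≥0∞) < RCPath.exit O p}, h (p.1 t) ∂(M.pathLaw q.2) := fun q h hh => by
    rw [hμ, integral_map (RCPath.measurable_eval t).aemeasurable hh.aestronglyMeasurable]
  have hcont : ∀ h : E →ᵇ ℝ, Continuous fun q => ∫ y, h y ∂(μ q) := by
    intro h
    obtain ⟨k, hk⟩ := hM t ht h
    have : (fun q => ∫ y, h y ∂(μ q)) = fun q => k q.2 := by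
      ext q
      have h1 : Measurable fun p : RCPath E => h (p.1 t) :=
        h.continuous.measurable.comp (RCPath.measurable_eval t)
      rw [hint q h.continuous.measurable, hk, pathLaw_apply,
        setIntegral_map hm h1.aestronglyMeasurable M.measurable_path.aemeasurable,
        ← integral_indicator (M.measurable_path hm)]
      refine integral_congr_ae ?_
      filter_upwards [M.exitTime_ae_eq hO q.2] with ω hω
      have h2 : (t : WithTop ℝ≥0) < M.exitTime O ω ↔
          ω ∈ M.path ⁻¹' {p | (t : ℝ≥0∞) < RCPath.exit O p} := by
        rw [hω, M.coe_lt_exitLimit_iff]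
        rfl
      by_cases h3 : ω ∈ M.path ⁻¹' {p | (t : ℝ≥0∞) < RCPath.exit O p}
      · rw [Set.indicator_of_mem h3, Set.indicator_of_mem
          (show ω ∈ {ω' | (t : WithTop ℝ≥0) < M.exitTime O ω'} from h2.2 h3)]
        rfl
      · rw [Set.indicator_of_notMem h3, Set.indicator_of_notMem
          (show ω ∉ {ω' | (t : WithTop ℝ≥0) < M.exitTime O ω'} from fun h4 => h3 (h2.1 h4))]
    rw [this]
    fun_prop
  have hg : (fun q : ℝ≥0 × E => ∫ p in {p | (t : ℝ≥0∞) < RCPath.exit O p},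
      g (q.1 + t, p.1 t) ∂(M.pathLaw q.2)) = fun q => ∫ y, g (q.1 + t, y) ∂(μ q) := by
    ext q
    rw [hint q (h := fun y => g (q.1 + t, y)) (g.continuous.comp (by fun_prop : Continuous fun y => (q.1 + t, y))).measurable]
  rw [hg, continuous_iff_continuousAt]
  intro q₀
  refine tendsto_integral_of_vague (z₀ := q₀)
    (fun h => ?_) ?_ (F := fun r => g (r.1.1 + t, r.2)) (by fun_prop)
    (C := ‖g‖) (fun r => g.norm_coe_le_norm _)
  · exact (hcont (h : C₀(E, ℝ)).toBCF).continuousAt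
  · have := (hcont (BoundedContinuousFunction.const E 1)).continuousAt (x := q₀)
    simpa [ContinuousAt] using this

lemma continuous_value_running {O : Set E} {γ : ℝ} (hγ : 0 < γ) (g : (ℝ≥0 × E) →ᵇ ℝ)
    (h : ∀ t : ℝ≥0, 0 < t → Continuous fun q : ℝ≥0 × E =>
      ∫ p in {p | (t : ℝ≥0∞) < RCPath.exit O p}, g (q.1 + t, p.1 t) ∂(M.pathLaw q.2)) :
    Continuous (M.value O γ g fun _ => 0) := by
  have := isFiniteMeasure_discount hγ
  have hg := g.boundedMeasurable
  have heq : M.value O γ g (fun _ => 0) = fun q => ∫ t : ℝ≥0,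
      ∫ p in {p | (t : ℝ≥0∞) < RCPath.exit O p}, g (q.1 + t, p.1 t) ∂(M.pathLaw q.2)
        ∂(discount γ) := by
    ext q
    exact M.value_zero_right O hγ hg q.1 q.2
  rw [heq]
  refine continuous_of_dominated (bound := fun _ => ‖g‖) (fun q => ?_)
    (fun q => Eventually.of_forall fun t => ?_) (integrable_const _) ?_
  · have h1 := ((RCPath.boundedMeasurable_running_integrand O hg).comp
      (f := fun r : ℝ≥0 × RCPath E => ((q.1, r.2), r.1)) (by fun_prop)).integral_measure
        (M.pathLaw q.2)
    refine h1.1.aestronglyMeasurable.congr (Eventually.of_forall fun t => ?_)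
    simp only
    rw [← integral_indicator (RCPath.measurableSet_lt_exit_right O t)]
    rfl
  · refine (norm_integral_le_of_norm_le_const (C := ‖g‖)
      (Eventually.of_forall fun p => g.norm_coe_le_norm _)).trans ?_
    rw [measureReal_restrict_apply_univ]
    exact mul_le_of_le_one_right (norm_nonneg _) measureReal_le_one
  · have h0 : ∀ᵐ t ∂(discount γ), t ≠ 0 := by
      rw [ae_iff]
      simp
    filter_upwards [h0] with t ht
    exact h t (pos_iff_ne_zero.2 ht)

lemma WeakFeller.continuous_potential (hM : M.WeakFeller) {γ : ℝ} (hγ : 0 < γ)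
    (g : (ℝ≥0 × E) →ᵇ ℝ) : Continuous (M.value Set.univ γ g fun _ => 0) := by
  refine continuous_value_running hγ g fun t _ => ?_
  have : (fun q : ℝ≥0 × E => ∫ p in {p | (t : ℝ≥0∞) < RCPath.exit Set.univ p},
      g (q.1 + t, p.1 t) ∂(M.pathLaw q.2)) =
      fun q => ∫ y, g (q.1 + t, y) ∂(M.transition t q.2) := by
    ext q
    rw [M.transition_eq_map_pathLaw, integral_map (RCPath.measurable_eval t).aemeasurable
      (g.boundedMeasurable.comp (f := fun y => (q.1 + t, y)) (by fun_prop)).1.aestronglyMeasurable]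
    simp
  rw [this]
  exact hM.continuous_transition t g

/-- Up to `δ/2`, `|ψ|` is dominated by a product `B a(s) χ(x)` of cut-offs. Then `a(s + t)` vanishes
as `s → ∞` and `Pₜχ` vanishes as `x → ∞` by the weak Feller property. Both factors are bounded, so
smallness of either one suffices to leave compact sets of the product. -/
lemma WeakFeller.tendsto_transition_cocompact (hM : M.WeakFeller) (t : ℝ≥0)
    (ψ : C₀(ℝ≥0 × E, ℝ)) :
    Tendsto (fun q : ℝ≥0 × E => ∫ y, ψ (q.1 + t, y) ∂(M.transition t q.2))
      (cocompact (ℝ≥0 × E)) (𝓝 0) := by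
  rw [Metric.tendsto_nhds]
  intro δ hδ
  have h0 : ∀ᶠ r in cocompact (ℝ≥0 × E), |ψ r| < δ / 2 := by
    have := (zero_at_infty ψ).eventually (Metric.ball_mem_nhds 0 (half_pos hδ))
    simpa using this
  obtain ⟨K, hK, hKψ⟩ := mem_cocompact.1 h0
  obtain ⟨a, ha1, ha01⟩ := exists_cutoff (hK.image continuous_fst)
  obtain ⟨χ, hχ1, hχ01⟩ := exists_cutoff (hK.image continuous_snd)
  obtain ⟨g, hg⟩ := hM.exists_zeroAtInfty t (χ : C₀(E, ℝ))
  have hg' : ∀ x, g x = ∫ y, χ y ∂(M.transition t x) := hg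
  set B := ‖ψ.toBCF‖ with hBdef
  have hB : ∀ r, |ψ r| ≤ B := fun r => ψ.toBCF.norm_coe_le_norm r
  have hbound : ∀ r : ℝ≥0 × E, |ψ r| ≤ δ / 2 + B * a r.1 * χ r.2 := by
    intro r
    by_cases hr : r ∈ K
    · rw [ha1 _ (Set.mem_image_of_mem _ hr), hχ1 _ (Set.mem_image_of_mem _ hr)]
      linarith [hB r]
    · have h1 : |ψ r| < δ / 2 := hKψ hr
      have h2 : 0 ≤ B * a r.1 * χ r.2 :=
        mul_nonneg (mul_nonneg (norm_nonneg _) (ha01 _).1) (hχ01 _).1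
      linarith
  have hle : ∀ q : ℝ≥0 × E, |∫ y, ψ (q.1 + t, y) ∂(M.transition t q.2)| ≤
      δ / 2 + B * a (q.1 + t) * g q.2 := by
    intro q
    have hχi : Integrable χ (M.transition t q.2) := χ.integrable'
    refine abs_integral_le_integral_abs.trans ?_
    refine (integral_mono_of_nonneg (Eventually.of_forall fun y => abs_nonneg _)
      ((integrable_const (δ / 2)).add (hχi.const_mul (B * a (q.1 + t))))
      (Eventually.of_forall fun y => hbound (q.1 + t, y))).trans ?_
    simp only [Pi.add_apply]
    rw [integral_add (integrable_const _) (hχi.const_mul _), integral_const_mul, ← hg']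
    simp
  have hg01 : ∀ x, |g x| ≤ 1 := by
    intro x
    rw [hg']
    have := norm_integral_le_of_norm_le_const (μ := M.transition t x) (f := χ) (C := 1)
      (Eventually.of_forall fun y => by
        rw [Real.norm_of_nonneg (hχ01 y).1]; exact (hχ01 y).2)
    simpa using this
  have hlim : Tendsto (fun q : ℝ≥0 × E => B * a (q.1 + t) * g q.2) (cocompact (ℝ≥0 × E))
      (𝓝 0) := by
    rw [← Filter.coprod_cocompact, Filter.coprod, tendsto_sup]
    constructor
    · have h1 : Tendsto (fun s : ℝ≥0 => B * a (s + t)) (cocompact ℝ≥0) (𝓝 0) := by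
        have h2 : Tendsto (fun s : ℝ≥0 => s + t) (cocompact ℝ≥0) (cocompact ℝ≥0) :=
          (Isometry.of_dist_eq fun a b => by
            simp [NNReal.dist_eq]).isClosedEmbedding.tendsto_cocompact
        have h3 := (zero_at_infty (a : C₀(ℝ≥0, ℝ))).comp h2
        simpa using h3.const_mul B
      have h4 := h1.comp (tendsto_comap (f := (Prod.fst : ℝ≥0 × E → ℝ≥0)))
      refine squeeze_zero_norm (a := fun q => |B * a (q.1 + t)|) (fun q => ?_)
        (by simpa only [abs_zero, Function.comp_def] using h4.abs)
      rw [norm_mul, ← Real.norm_eq_abs (B * a _)]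
      exact mul_le_of_le_one_right (norm_nonneg _) (hg01 _)
    · have h4 := (zero_at_infty g).comp (tendsto_comap (f := (Prod.snd : ℝ≥0 × E → E)))
      refine squeeze_zero_norm (a := fun q => B * |g q.2|) (fun q => ?_)
        (by simpa using h4.abs.const_mul B)
      rw [norm_mul, norm_mul, Real.norm_of_nonneg (norm_nonneg ψ.toBCF),
        Real.norm_of_nonneg (ha01 _).1, Real.norm_eq_abs]
      exact mul_le_mul_of_nonneg_right (mul_le_of_le_one_right (norm_nonneg _) (ha01 _).2)
        (abs_nonneg _)
  filter_upwards [hlim.eventually (isOpen_Iio.mem_nhds (half_pos hδ))] with q hq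
  have hq' : B * a (q.1 + t) * g q.2 < δ / 2 := hq
  rw [dist_zero_right, Real.norm_eq_abs]
  linarith [hle q]

/-- The potential of a function vanishing at infinity vanishes at infinity. -/
lemma WeakFeller.exists_potential (hM : M.WeakFeller) {γ : ℝ} (hγ : 0 < γ)
    (ψ : C₀(ℝ≥0 × E, ℝ)) :
    ∃ g : C₀(ℝ≥0 × E, ℝ), ⇑g = M.value Set.univ γ ψ fun _ => 0 := by
  have := isFiniteMeasure_discount hγ
  have hc : Continuous (M.value Set.univ γ ψ fun _ => 0) := hM.continuous_potential hγ ψ.toBCF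
  have hψ : BoundedMeasurable ψ := BoundedContinuousFunction.boundedMeasurable ψ.toBCF
  refine ⟨⟨⟨_, hc⟩, ?_⟩, rfl⟩
  have heq : (M.value Set.univ γ ψ fun _ => 0) =
      fun q => ∫ t, ∫ y, ψ (q.1 + t, y) ∂(M.transition t q.2) ∂(discount γ) := by
    ext q
    exact M.value_univ hγ hψ q.1 q.2
  change Tendsto (M.value Set.univ γ ψ fun _ => 0) _ _
  rw [heq]
  have := isCountablyGenerated_cocompact (ℝ≥0 × E)
  have h0 : (0 : ℝ) = ∫ _, 0 ∂(discount γ) := by simp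
  rw [h0]
  refine tendsto_integral_filter_of_dominated_convergence (fun _ => ‖ψ.toBCF‖)
    (Eventually.of_forall fun q => ?_) (Eventually.of_forall fun q => Eventually.of_forall fun t => ?_)
    (integrable_const _) (Eventually.of_forall fun t => hM.tendsto_transition_cocompact t ψ)
  · have h1 := ((RCPath.boundedMeasurable_running_integrand Set.univ hψ).comp
      (f := fun r : ℝ≥0 × RCPath E => ((q.1, r.2), r.1)) (by fun_prop)).integral_measure
        (M.pathLaw q.2)
    refine h1.1.aestronglyMeasurable.congr (Eventually.of_forall fun t => ?_)
    simp only
    rw [M.transition_eq_map_pathLaw, integral_map (RCPath.measurable_eval t).aemeasurable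
      (hψ.comp (f := fun y => (q.1 + t, y)) (by fun_prop)).1.aestronglyMeasurable]
    simp
  · have := norm_integral_le_of_norm_le_const (μ := M.transition t q.2) (C := ‖ψ.toBCF‖)
      (f := fun y => ψ (q.1 + t, y)) (Eventually.of_forall fun p => ψ.toBCF.norm_coe_le_norm _)
    simpa using this

end StandardMarkovProcess

/-! ### The discounted exit law and continuity of the value -/

namespace StandardMarkovProcess

section

variable {E : Type*} [MetricSpace E] [MeasurableSpace E] [BorelSpace E]
  {Ω : Type*} [MeasurableSpace Ω] (M : StandardMarkovProcess E Ω)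

/-- The discounted law of the exit time and the exit place. -/
noncomputable def exitLaw (O : Set E) (γ : ℝ) (x : E) : Measure (ℝ≥0 × E) :=
  (((M.pathLaw x).restrict {p | RCPath.exit O p ≠ ⊤}).withDensity fun p =>
    ENNReal.ofReal (Real.exp (-γ * (RCPath.exit O p).toNNReal))).map
      fun p => ((RCPath.exit O p).toNNReal, p.1 (RCPath.exit O p).toNNReal)

lemma isFiniteMeasure_exitLaw (O : Set E) {γ : ℝ} (hγ : 0 ≤ γ) (x : E) :
    IsFiniteMeasure (M.exitLaw O γ x) := by
  have hT := measurable_exit_toNNReal (E := E) O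
  have h : BoundedMeasurable fun p : RCPath E =>
      Real.exp (-γ * (RCPath.exit O p).toNNReal) := by
    refine ⟨by fun_prop, 1, fun p => ?_⟩
    rw [abs_of_nonneg (Real.exp_nonneg _), Real.exp_le_one_iff, neg_mul]
    exact neg_nonpos.2 (by positivity)
  have := isFiniteMeasure_withDensity_ofReal
    (integrable_of_bounded (μ := (M.pathLaw x).restrict {p | RCPath.exit O p ≠ ⊤}) h).2
  exact Measure.isFiniteMeasure_map _ _

/-- The starting time enters only through the integrand, so continuity in `(s, x)` reduces to weak
continuity of a family indexed by `x` alone. -/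
lemma integral_exitLaw (O : Set E) (γ : ℝ) {h : ℝ≥0 × E → ℝ} (hh : Measurable h)
    (s : ℝ≥0) (x : E) :
    ∫ r, h (s + r.1, r.2) ∂(M.exitLaw O γ x) = M.value O γ (fun _ => 0) h (s, x) := by
  have hT := measurable_exit_toNNReal (E := E) O
  have hm : Measurable fun r : ℝ≥0 × E => h (s + r.1, r.2) := hh.comp (by fun_prop)
  rw [M.integral_exit, exitLaw, integral_map (hT.prodMk (RCPath.measurable_eval_exit O)).aemeasurable
    hm.aestronglyMeasurable, integral_withDensity_eq_integral_toReal_smul (by fun_prop) (by simp)]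
  simp [ENNReal.toReal_ofReal (Real.exp_nonneg _)]

lemma value_univ_const {γ : ℝ} (hγ : 0 < γ) (q : ℝ≥0 × E) :
    M.value Set.univ γ (fun _ => γ) (fun _ => 0) q = 1 := by
  rw [← Prod.mk.eta (p := q), M.value_univ hγ (.const γ)]
  have h := integral_discount_one hγ
  simp only [integral_const, smul_eq_mul, mul_one, probReal_univ, one_mul] at h ⊢
  rw [h]
  field_simp

/-- The constant `1` is the `γ`-potential of the constant `γ`, so `value_exit_potential` expresses
`𝔼ˣ[e^{-γτ}]` by a running payoff, whose continuity comes from (A1). -/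
lemma measureReal_exitLaw_univ (O : Set E) {γ : ℝ} (hγ : 0 < γ) (x : E) :
    (M.exitLaw O γ x).real Set.univ = 1 - M.value O γ (fun _ => γ) (fun _ => 0) (0, x) := by
  have h1 := M.value_exit_potential O hγ (BoundedMeasurable.const γ) (0, x)
  rw [M.value_univ_const hγ, funext (M.value_univ_const hγ)] at h1
  rw [← h1, ← M.integral_exitLaw O γ measurable_const]
  simp

lemma measureReal_exitLaw_univ_le (O : Set E) {γ : ℝ} (hγ : 0 < γ) (x : E) :
    (M.exitLaw O γ x).real Set.univ ≤ 1 := by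
  rw [M.measureReal_exitLaw_univ O hγ, M.value_zero_right O hγ (.const γ), sub_le_self_iff]
  exact integral_nonneg fun u => integral_nonneg fun p => hγ.le

/-- The normalized potentials `n U_{γ + n} h` converge pointwise to `h`. -/
lemma tendsto_mul_value_univ {γ : ℝ} (hγ : 0 < γ) (h : (ℝ≥0 × E) →ᵇ ℝ) (q : ℝ≥0 × E) :
    Tendsto (fun n : ℕ => (n : ℝ) * M.value Set.univ (γ + n) h (fun _ => 0) q) atTop
      (𝓝 (h q)) := by
  obtain ⟨s, x⟩ := q
  have hm : ∀ u : ℝ≥0, Measurable fun p : RCPath E => h (s + u, p.1 u) := fun u =>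
    (h.boundedMeasurable.comp (measurable_const.prodMk (RCPath.measurable_eval u))).1
  set F : ℝ≥0 → ℝ := fun u => ∫ p, h (s + u, p.1 u) ∂(M.pathLaw x) with hF
  have hFb : BoundedMeasurable F := by
    have := ((RCPath.boundedMeasurable_running_integrand Set.univ h.boundedMeasurable).comp
      (f := fun r : ℝ≥0 × RCPath E => ((s, r.2), r.1)) (by fun_prop)).integral_measure
        (M.pathLaw x)
    simpa using this
  have hF0 : F 0 = h (s, x) := by
    have h1 : ∀ᵐ p ∂(M.pathLaw x), p.1 0 = x := by
      rw [pathLaw_apply, ae_map_iff (p := fun p : RCPath E => p.1 0 = x)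
        M.measurable_path.aemeasurable (RCPath.measurable_eval 0 (measurableSet_singleton x))]
      exact M.start x
    rw [hF]
    simp only [add_zero]
    rw [integral_congr_ae (h1.mono fun p hp => by simp only [hp] : _ =ᵐ[_] fun _ => h (s, x))]
    simp
  have hFc : ContinuousAt F 0 := by
    refine tendsto_integral_filter_of_dominated_convergence (fun _ => ‖h‖)
      (Eventually.of_forall fun u => (hm u).aestronglyMeasurable)
      (Eventually.of_forall fun u => Eventually.of_forall fun p => h.norm_coe_le_norm _)
      (integrable_const _) (Eventually.of_forall fun p => ?_)
    -- Time `0` is the least element, so right-continuity there is continuity.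
    have h1 : ContinuousAt p.1 0 := by
      have := p.2 0
      rwa [show Set.Ici (0 : ℝ≥0) = Set.univ from Set.Ici_bot, continuousWithinAt_univ] at this
    exact (h.continuous.continuousAt (x := (s + 0, p.1 0))).comp
      (f := fun u : ℝ≥0 => (s + u, p.1 u)) (by fun_prop)
  rw [← hF0]
  refine (tendsto_mul_integral_discount hγ hFb hFc).congr fun n => ?_
  rw [M.value_zero_right _ (by positivity) h.boundedMeasurable]
  simp [hF]

end

variable {E : Type*} [MetricSpace E] [ProperSpace E] [MeasurableSpace E] [BorelSpace E]
  {Ω : Type*} [MeasurableSpace Ω] {M : StandardMarkovProcess E Ω}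

/-- The running part is continuous by (A1). The exit part is an integral against `exitLaw`, whose
weak continuity is deduced from its mass and its action on potentials, both computable from
unstopped potentials and running payoffs. -/
lemma continuous_value_of_feller {O : Set E} (hO : IsOpen O) (hM : M.WeakFeller)
    (hS : M.StoppedFeller O) {γ : ℝ} (hγ : 0 < γ) (g h : (ℝ≥0 × E) →ᵇ ℝ) :
    Continuous (M.value O γ g h) := by
  have hrun : ∀ ψ : (ℝ≥0 × E) →ᵇ ℝ, Continuous (M.value O γ ψ fun _ => 0) := fun ψ =>
    continuous_value_running hγ ψ fun t ht => hS.continuous_stopped hO ht ψ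
  have hfin : ∀ q : ℝ≥0 × E, IsFiniteMeasure (M.exitLaw O γ q.2) := fun q =>
    M.isFiniteMeasure_exitLaw O hγ.le q.2
  have hmass : Continuous fun q : ℝ≥0 × E => (M.exitLaw O γ q.2).real Set.univ := by
    simp only [M.measureReal_exitLaw_univ O hγ]
    have := hrun (BoundedContinuousFunction.const _ γ)
    exact continuous_const.sub (this.comp (by fun_prop : Continuous fun q : ℝ≥0 × E => ((0 : ℝ≥0), q.2)))
  have hpot : ∀ ψ : (ℝ≥0 × E) →ᵇ ℝ, Continuous fun q : ℝ≥0 × E =>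
      ∫ r, M.value Set.univ γ ψ (fun _ => 0) r ∂(M.exitLaw O γ q.2) := by
    intro ψ
    have hψ := ψ.boundedMeasurable
    have heq : (fun q : ℝ≥0 × E =>
        ∫ r, M.value Set.univ γ ψ (fun _ => 0) r ∂(M.exitLaw O γ q.2)) = fun q =>
        M.value Set.univ γ ψ (fun _ => 0) (0, q.2) - M.value O γ ψ (fun _ => 0) (0, q.2) := by
      ext q
      rw [← M.value_exit_potential O hγ hψ,
        ← M.integral_exitLaw O γ (M.boundedMeasurable_value _ hγ hψ (.const 0)).1]
      simp
    rw [heq]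
    exact ((hM.continuous_potential hγ ψ).sub (hrun ψ)).comp
      (by fun_prop : Continuous fun q : ℝ≥0 × E => ((0 : ℝ≥0), q.2))
  -- The test functions are `n U_{γ+n} k`: they vanish at infinity, are bounded by `‖k‖` because
  -- `discount (γ + n)` has mass `1/(γ + n)`, and converge pointwise to `k`.
  have hvague : ∀ (q₀ : ℝ≥0 × E) (k : C_c(ℝ≥0 × E, ℝ)),
      Tendsto (fun q : ℝ≥0 × E => ∫ r, k r ∂(M.exitLaw O γ q.2)) (𝓝 q₀)
        (𝓝 (∫ r, k r ∂(M.exitLaw O γ q₀.2))) := by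
    intro q₀
    refine vague_of_dense (μ := fun q : ℝ≥0 × E => M.exitLaw O γ q.2) (C := 1)
      (fun q => M.measureReal_exitLaw_univ_le O hγ q.2) fun k => ?_
    set kb : (ℝ≥0 × E) →ᵇ ℝ := (k : C₀(ℝ≥0 × E, ℝ)).toBCF with hkb
    have hk : BoundedMeasurable k := kb.boundedMeasurable
    have hγn : ∀ n : ℕ, 0 < γ + n := fun n => by positivity
    choose v hv using fun n : ℕ => hM.exists_potential (hγn n) (k : C₀(ℝ≥0 × E, ℝ))
    have hv' : ∀ n, ⇑(v n) = M.value Set.univ (γ + n) k fun _ => 0 := hv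
    refine ⟨fun n => (n : ℝ) • v n, ‖kb‖, fun n q => ?_, fun q => ?_, fun n => ?_⟩
    · have := isFiniteMeasure_discount (hγn n)
      have h1 : |v n q| ≤ ‖kb‖ * (1 / (γ + n)) := by
        rw [hv', ← Prod.mk.eta (p := q), M.value_univ (hγn n) hk,
          ← integral_discount_one (hγn n), ← integral_const_mul]
        simp only [mul_one]
        rw [← Real.norm_eq_abs]
        refine norm_integral_le_of_norm_le (integrable_const _) (Eventually.of_forall fun u => ?_)
        have := norm_integral_le_of_norm_le_const (μ := M.transition u q.2) (C := ‖kb‖)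
          (f := fun y => k (q.1 + u, y)) (Eventually.of_forall fun y => kb.norm_coe_le_norm _)
        simpa using this
      have h2 : (n : ℝ) / (γ + n) ≤ 1 := (div_le_one (hγn n)).2 (by linarith)
      change |(n : ℝ) * v n q| ≤ _
      rw [abs_mul, Nat.abs_cast]
      calc (n : ℝ) * |v n q| ≤ n * (‖kb‖ * (1 / (γ + n))) := by gcongr
        _ = ‖kb‖ * (n / (γ + n)) := by ring
        _ ≤ ‖kb‖ := mul_le_of_le_one_right (norm_nonneg _) h2
    · change Tendsto (fun n : ℕ => (n : ℝ) * v n q) _ _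
      simp only [hv']
      exact M.tendsto_mul_value_univ hγ kb q
    -- The resolvent identity reads `U_{γ+n} k = U_γ(k - n U_{γ+n} k)`: every test function is a
    -- potential of the single rate `γ`, to which `hpot` applies.
    · have h1 : ⇑(v n) = M.value Set.univ γ (kb + (γ - (γ + n)) • (v n).toBCF : (ℝ≥0 × E) →ᵇ ℝ)
          fun _ => 0 := by
        refine (hv' n).trans ((M.value_eq_value_add Set.univ (hγn n) hγ hk (.const 0)).trans ?_)
        rw [← hv']
        rfl
      have h2 := (hpot (kb + (γ - (γ + n)) • (v n).toBCF)).continuousAt (x := q₀)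
      rw [← h1] at h2
      have h3 := h2.tendsto.const_mul (n : ℝ)
      simp only [← integral_const_mul] at h3
      exact h3
  have hexit : Continuous (M.value O γ (fun _ => 0) h) := by
    have heq : M.value O γ (fun _ => 0) h =
        fun q => ∫ r, h (q.1 + r.1, r.2) ∂(M.exitLaw O γ q.2) := by
      ext q
      exact (M.integral_exitLaw O γ h.boundedMeasurable.1 q.1 q.2).symm
    rw [heq, continuous_iff_continuousAt]
    intro q₀
    exact tendsto_integral_of_vague (μ := fun q : ℝ≥0 × E => M.exitLaw O γ q.2) (z₀ := q₀)
      (hvague q₀) hmass.continuousAt.tendsto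
      (F := fun r => h (r.1.1 + r.2.1, r.2.2)) (by fun_prop) (C := ‖h‖)
      (fun r => h.norm_coe_le_norm _)
  have heq : M.value O γ g h = fun q =>
      M.value O γ g (fun _ => 0) q + M.value O γ (fun _ => 0) h q :=
    funext (M.value_eq_add O hγ g.boundedMeasurable h.boundedMeasurable)
  rw [heq]
  exact (hrun g).add hexit

end StandardMarkovProcess

/-! ### The contraction and its fixed point -/

lemma BoundedMeasurable.bddAbove_abs_sub {S : Type*} [MeasurableSpace S] {φ ψ : S → ℝ}
    (hφ : BoundedMeasurable φ) (hψ : BoundedMeasurable ψ) :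
    BddAbove (Set.range fun q => |φ q - ψ q|) := by
  obtain ⟨-, C, hC⟩ := hφ.sub hψ
  exact ⟨C, Set.forall_mem_range.2 hC⟩

/-- The penalized reward `f + β (G - φ)⁺ + β φ` is Lipschitz in `φ` with constant `β`. -/
lemma abs_penalty_sub_le {β : ℝ} (hβ : 0 ≤ β) (f G a b : ℝ) :
    |(f + β * max (G - a) 0 + β * a) - (f + β * max (G - b) 0 + β * b)| ≤ β * |a - b| := by
  -- Adding `β φ` completes the penalty to a maximum, so the Lipschitz constant is `β` and not `2β`.
  have h : ∀ c, f + β * max (G - c) 0 + β * c = f + β * max G c := fun c => by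
    rw [add_assoc, ← mul_add, max_add, sub_add_cancel, zero_add]
  rw [h, h, add_sub_add_left_eq_sub, ← mul_sub, abs_mul, abs_of_nonneg hβ]
  refine mul_le_mul_of_nonneg_left ?_ hβ
  have := abs_max_sub_max_le_max G a G b
  simpa using this

/-- A sup-norm contraction estimate between two bounded functions forces them to agree. -/
lemma BoundedMeasurable.eq_of_abs_sub_le {S : Type*} [MeasurableSpace S] {φ ψ : S → ℝ}
    (hφ : BoundedMeasurable φ) (hψ : BoundedMeasurable ψ) {c : ℝ} (hc : c < 1)
    (h : ∀ q, |φ q - ψ q| ≤ c * ⨆ r, |φ r - ψ r|) : φ = ψ := by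
  rcases isEmpty_or_nonempty S with hS | hS
  · exact funext fun q => hS.elim q
  have hle : ⨆ r, |φ r - ψ r| ≤ c * ⨆ r, |φ r - ψ r| := ciSup_le h
  have h0 : ∀ q, |φ q - ψ q| ≤ ⨆ r, |φ r - ψ r| := le_ciSup (hφ.bddAbove_abs_sub hψ)
  have hsup : ⨆ r, |φ r - ψ r| ≤ 0 := by
    by_contra! hpos
    nlinarith
  ext q
  exact sub_eq_zero.1 (abs_nonpos_iff.1 ((h0 q).trans hsup))

lemma boundedMeasurable_penalty {S : Type*} [MeasurableSpace S] {f G φ : S → ℝ} (β : ℝ)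
    (hf : BoundedMeasurable f) (hG : BoundedMeasurable G) (hφ : BoundedMeasurable φ) :
    BoundedMeasurable fun q => f q + β * max (G q - φ q) 0 :=
  hf.add (((hG.sub hφ).max (.const 0)).const_mul β)

namespace StandardMarkovProcess

variable {E : Type*} [MetricSpace E] [MeasurableSpace E] [BorelSpace E]
  {Ω : Type*} [MeasurableSpace Ω] (M : StandardMarkovProcess E Ω)

/-- The exit payoffs cancel, and the running payoffs are integrated against a measure of mass `1/γ`.
-/
lemma abs_value_sub_le (O : Set E) {γ : ℝ} (hγ : 0 < γ) {g₁ g₂ h : ℝ≥0 × E → ℝ}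
    (hg₁ : BoundedMeasurable g₁) (hg₂ : BoundedMeasurable g₂) (hh : BoundedMeasurable h) {C : ℝ}
    (hC : ∀ r, |g₁ r - g₂ r| ≤ C) (q : ℝ≥0 × E) :
    |M.value O γ g₁ h q - M.value O γ g₂ h q| ≤ C / γ := by
  have := isFiniteMeasure_discount hγ
  have hmass : (discount γ).real Set.univ = 1 / γ := by
    simpa using integral_discount_one hγ
  have hC0 : 0 ≤ C := (abs_nonneg _).trans (hC q)
  have hint : ∀ {g : ℝ≥0 × E → ℝ}, BoundedMeasurable g → ∀ p : RCPath E,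
      Integrable ({u : ℝ≥0 | (u : ℝ≥0∞) < RCPath.exit O p}.indicator
        (fun u => g (q.1 + u, p.1 u))) (discount γ) := fun hg p =>
    integrable_of_bounded ((RCPath.boundedMeasurable_running_integrand O hg).comp
      (f := fun u => ((q.1, p), u)) (by fun_prop))
  have hpath : ∀ p : RCPath E,
      ‖RCPath.payoff O γ g₁ h q.1 p - RCPath.payoff O γ g₂ h q.1 p‖ ≤ C / γ := by
    intro p
    rw [RCPath.payoff, RCPath.payoff, add_sub_add_right_eq_sub, RCPath.running, RCPath.running,
      ← integral_sub (hint hg₁ p) (hint hg₂ p), div_eq_mul_one_div, ← hmass]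
    refine norm_integral_le_of_norm_le_const (Eventually.of_forall fun u => ?_)
    by_cases hu : u ∈ {u : ℝ≥0 | (u : ℝ≥0∞) < RCPath.exit O p}
    · rw [Set.indicator_of_mem hu, Set.indicator_of_mem hu]
      exact hC _
    · rw [Set.indicator_of_notMem hu, Set.indicator_of_notMem hu]
      simpa using hC0
  rw [value, value, ← integral_sub (M.integrable_payoff O hγ hg₁ hh q.1 q.2)
    (M.integrable_payoff O hγ hg₂ hh q.1 q.2)]
  have := norm_integral_le_of_norm_le_const (μ := M.pathLaw q.2) (Eventually.of_forall hpath)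
  simpa using this

variable {O : Set E} {α β : ℝ} {f G H : ℝ≥0 × E → ℝ}

lemma penaltyOperator_eq_value (hO : IsOpen O) (hαβ : 0 < α + β) (hf : BoundedMeasurable f)
    (hG : BoundedMeasurable G) (hH : BoundedMeasurable H) {φ : ℝ≥0 × E → ℝ}
    (hφ : BoundedMeasurable φ) :
    M.penaltyOperator O α β f G H φ =
      M.value O (α + β) (fun q => f q + β * max (G q - φ q) 0 + β * φ q) H :=
  M.expectedPayoff_eq_value hO hαβ ((boundedMeasurable_penalty β hf hG hφ).add (hφ.const_mul β)) hH

lemma abs_penaltyOperator_sub_le (hO : IsOpen O) (hαβ : 0 < α + β) (hβ : 0 ≤ β)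
    (hf : BoundedMeasurable f) (hG : BoundedMeasurable G) (hH : BoundedMeasurable H)
    {φ₁ φ₂ : ℝ≥0 × E → ℝ} (hφ₁ : BoundedMeasurable φ₁) (hφ₂ : BoundedMeasurable φ₂)
    (q : ℝ≥0 × E) :
    |M.penaltyOperator O α β f G H φ₁ q - M.penaltyOperator O α β f G H φ₂ q| ≤
      β / (α + β) * ⨆ r, |φ₁ r - φ₂ r| := by
  rw [M.penaltyOperator_eq_value hO hαβ hf hG hH hφ₁, M.penaltyOperator_eq_value hO hαβ hf hG hH hφ₂,
    div_mul_eq_mul_div]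
  refine M.abs_value_sub_le O hαβ ((boundedMeasurable_penalty β hf hG hφ₁).add (hφ₁.const_mul β))
    ((boundedMeasurable_penalty β hf hG hφ₂).add (hφ₂.const_mul β)) hH (fun r => ?_) q
  exact (abs_penalty_sub_le hβ _ _ _ _).trans (mul_le_mul_of_nonneg_left
    (le_ciSup (hφ₁.bddAbove_abs_sub hφ₂) r) hβ)

/-- A bounded measurable function solves the penalized equation if and only if it is a fixed
point of the penalty operator. -/
lemma solvesPenalized_iff (hO : IsOpen O) (hα : 0 < α) (hβ : 0 < β) (hf : BoundedMeasurable f)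
    (hG : BoundedMeasurable G) (hH : BoundedMeasurable H) {w : ℝ≥0 × E → ℝ}
    (hw : BoundedMeasurable w) :
    M.SolvesPenalized O α β f G H w ↔ M.penaltyOperator O α β f G H w = w := by
  have hαβ : 0 < α + β := add_pos hα hβ
  have hg := boundedMeasurable_penalty β hf hG hw
  set g : ℝ≥0 × E → ℝ := fun q => f q + β * max (G q - w q) 0 with hgdef
  set v := M.value O α g H with hv
  have hvm : BoundedMeasurable v := M.boundedMeasurable_value O hα hg hH
  -- Raising the rate from `α` to `α + β` is exactly what adds the term `β v` to the reward.
  have hres : v = M.value O (α + β) (fun q => g q + β * v q) H := by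
    have := M.value_eq_value_add O hα hαβ hg hH
    rwa [add_sub_cancel_left, ← hv] at this
  have hop : M.penaltyOperator O α β f G H w = M.value O (α + β) (fun q => g q + β * w q) H :=
    M.penaltyOperator_eq_value hO hαβ hf hG hH hw
  have hsolves : M.SolvesPenalized O α β f G H w ↔ w = v := by
    rw [hv, ← M.expectedPayoff_eq_value hO hα hg hH, funext_iff]
    rfl
  rw [hsolves, hop]
  constructor
  · intro h
    conv_rhs => rw [h, hres, ← h]
  · intro h
    -- With `g` frozen at `w`, both `w` and `v` are fixed points of `u ↦ M.value O (α + β) (g + β u)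
    -- H`, which contracts with constant `β / (α + β)`.
    refine hw.eq_of_abs_sub_le hvm (c := β / (α + β)) ((div_lt_one hαβ).2 (by linarith)) fun q => ?_
    rw [← congrFun h q, congrFun hres q, div_mul_eq_mul_div]
    refine M.abs_value_sub_le O hαβ (hg.add (hw.const_mul β)) (hg.add (hvm.const_mul β)) hH
      (fun r => ?_) q
    rw [add_sub_add_left_eq_sub, ← mul_sub, abs_mul, abs_of_pos hβ]
    exact mul_le_mul_of_nonneg_left (le_ciSup (hw.bddAbove_abs_sub hvm) r) hβ.le

end StandardMarkovProcess

theorem mainTheorem10 {E : Type*} [MetricSpace E] [ProperSpace E] [MeasurableSpace E]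
    [BorelSpace E] {Ω : Type*} [MeasurableSpace Ω] (M : StandardMarkovProcess E Ω)
    (hFeller : M.WeakFeller) (O : Set E) (hO : IsOpen O) (hA1 : M.StoppedFeller O)
    (α β : ℝ) (hα : 0 < α) (hβ : 0 < β) (f G H : (ℝ≥0 × E) →ᵇ ℝ) :
    (∀ φ : ℝ≥0 × E → ℝ, BoundedMeasurable φ →
      BoundedMeasurable (M.penaltyOperator O α β f G H φ)) ∧
    (∀ φ₁ φ₂ : ℝ≥0 × E → ℝ, BoundedMeasurable φ₁ → BoundedMeasurable φ₂ →
      ∀ p, |M.penaltyOperator O α β f G H φ₁ p - M.penaltyOperator O α β f G H φ₂ p| ≤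
        β / (α + β) * ⨆ q, |φ₁ q - φ₂ q|) ∧
    ∃ T : ((ℝ≥0 × E) →ᵇ ℝ) → ((ℝ≥0 × E) →ᵇ ℝ),
      (∀ φ : (ℝ≥0 × E) →ᵇ ℝ, ⇑(T φ) = M.penaltyOperator O α β f G H φ) ∧
      ContractingWith (β / (α + β)).toNNReal T ∧
      ∃ w : (ℝ≥0 × E) →ᵇ ℝ,
        M.SolvesPenalized O α β f G H w ∧
        (∀ v : ℝ≥0 × E → ℝ, BoundedMeasurable v → M.SolvesPenalized O α β f G H v → v = w) ∧
        Function.IsFixedPt T w ∧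
        (∀ v : ℝ≥0 × E → ℝ, BoundedMeasurable v →
          M.penaltyOperator O α β f G H v = v → v = w) := by
  have hαβ : 0 < α + β := add_pos hα hβ
  have hc0 : 0 ≤ β / (α + β) := by positivity
  have hc1 : β / (α + β) < 1 := (div_lt_one hαβ).2 (by linarith)
  have hf := f.boundedMeasurable
  have hG := G.boundedMeasurable
  have hH := H.boundedMeasurable
  have hbm : ∀ φ : ℝ≥0 × E → ℝ, BoundedMeasurable φ →
      BoundedMeasurable (M.penaltyOperator O α β f G H φ) := fun φ hφ => by
    rw [M.penaltyOperator_eq_value hO hαβ hf hG hH hφ]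
    exact M.boundedMeasurable_value O hαβ
      ((boundedMeasurable_penalty β hf hG hφ).add (hφ.const_mul β)) hH
  have hle : ∀ φ₁ φ₂ : ℝ≥0 × E → ℝ, BoundedMeasurable φ₁ → BoundedMeasurable φ₂ →
      ∀ p, |M.penaltyOperator O α β f G H φ₁ p - M.penaltyOperator O α β f G H φ₂ p| ≤
        β / (α + β) * ⨆ q, |φ₁ q - φ₂ q| := fun φ₁ φ₂ h₁ h₂ p =>
    M.abs_penaltyOperator_sub_le hO hαβ hβ.le hf hG hH h₁ h₂ p
  -- Banach's theorem will give uniqueness only among continuous functions; the estimate `hle`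
  -- extends it to bounded measurable ones.
  have hfix : ∀ v w : ℝ≥0 × E → ℝ, BoundedMeasurable v → BoundedMeasurable w →
      M.penaltyOperator O α β f G H v = v → M.penaltyOperator O α β f G H w = w → v = w := by
    intro v w hv hw hv' hw'
    refine hv.eq_of_abs_sub_le hw hc1 fun q => ?_
    have := hle v w hv hw q
    rwa [hv', hw'] at this
  have hcont : ∀ φ : (ℝ≥0 × E) →ᵇ ℝ, Continuous (M.penaltyOperator O α β f G H φ) := fun φ => by
    rw [M.penaltyOperator_eq_value hO hαβ hf hG hH φ.boundedMeasurable]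
    exact StandardMarkovProcess.continuous_value_of_feller hO hFeller hA1 hαβ
      (f + β • ((G - φ) ⊔ 0) + β • φ) H
  choose T hT using fun φ : (ℝ≥0 × E) →ᵇ ℝ =>
    show ∃ ψ : (ℝ≥0 × E) →ᵇ ℝ, ⇑ψ = M.penaltyOperator O α β f G H φ from
      let ⟨C, hC⟩ := (hbm φ φ.boundedMeasurable).2
      ⟨BoundedContinuousFunction.ofNormedAddCommGroup _ (hcont φ) C hC, rfl⟩
  have hcontr : ContractingWith (β / (α + β)).toNNReal T := by
    refine ⟨by rwa [← NNReal.coe_lt_coe, Real.coe_toNNReal _ hc0], LipschitzWith.of_dist_le_mul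
      fun φ₁ φ₂ => ?_⟩
    rw [Real.coe_toNNReal _ hc0, BoundedContinuousFunction.dist_le (by positivity)]
    intro q
    rw [hT, hT, Real.dist_eq]
    refine (hle φ₁ φ₂ φ₁.boundedMeasurable φ₂.boundedMeasurable q).trans
      (mul_le_mul_of_nonneg_left (Real.iSup_le (fun r => ?_) dist_nonneg) hc0)
    rw [← Real.dist_eq]
    exact BoundedContinuousFunction.dist_coe_le_dist r
  set w := hcontr.fixedPoint T with hw
  have hwfix : Function.IsFixedPt T w := hcontr.fixedPoint_isFixedPt
  have hwop : M.penaltyOperator O α β f G H w = w := by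
    rw [← hT, hwfix]
  refine ⟨hbm, hle, T, hT, hcontr, w,
    (M.solvesPenalized_iff hO hα hβ hf hG hH w.boundedMeasurable).2 hwop, fun v hv hvs => ?_,
    hwfix, fun v hv hvf => hfix v w hv w.boundedMeasurable hvf hwop⟩
  exact hfix v w hv w.boundedMeasurable
    ((M.solvesPenalized_iff hO hα hβ hf hG hH hv).1 hvs) hwop
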